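/- Let $N\ge 1$ and let $h$ be a non-zero complex number. The Yangian $Y_h(\mathfrak{gl}_N)$ is the unital associative $\mathbb{C}$-algebra generated by $T_{ij}[r]$ ($1\le i,j\le N$, $r\ge 0$), the coefficients of the formal series $T_{ij}(x)=\sum_{r\ge 0}T_{ij}[r]x^{-r}$, subject to $R(x,y)\,T_1(x)T_2(y)=T_2(y)T_1(x)\,R(x,y)$, where $T(x)=\sum_{i,j}E_{ij}\otimes T_{ij}(x)$, $T_1(x)=T(x)\otimes 1$, $T_2(y)=1\otimes T(y)$, and $$R(x,y)=(x-y+h)\sum_{i}E_{ii}\otimes E_{ii}+(x-y)\sum_{i\ne j}E_{ii}\otimes E_{jj}+h\sum_{i\neq j}E_{ij}\otimes E_{ji}.$$ Conventions. For finite families $\overline u,\overline v$ of variables put $\overline u-\overline v=\prod_{a,b}(u_a-v_b)$ and $\overline u-\overline v+h=\prod_{a,b}(u_a-v_b+h)$; put $T_{ij}(\overline u)=\prod_a T_{ij}(u_a)$ (these factors commute). Empty products are $1$. Rational weight functions. Let $\boldsymbol I=(i_1,\dots,i_L)$ with $i_c\in\{1,\dots,N\}$. For $1\le p\le N$ let $\boldsymbol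 I^p=\{c: i_c\le p\}$, let $k_p=|\boldsymbol I^p|$, and for $p<N$ let $\widetilde I^p_1<\dots<\widetilde I^p_{k_p}$ be the positions of the elements of $\boldsymbol I^p$ within $\boldsymbol I^{p+1}$, whose elements are numbered increasingly by $1,\dots,k_{p+1}$. For families $\overline x^p=(x^p_1,\dots,x^p_{k_p})$, $1\le p\le N-1$, and $\overline y=(y_1,\dots,y_L)$, put $x^N=\overline y$, let $\sigma_N$ be the identity, and set $$W(\overline x^1,\dots,\overline x^{N-1}|\overline y|\boldsymbol I)=\sum_{\sigma_1\in S_{k_1}}\cdots\sum_{\sigma_{N-1}\in S_{k_{N-1}}}\prod_{p=1}^{N-1}\Bigg\{\prod_{a=1}^{k_p}\Bigg(\prod_{i=1}^{\widetilde I^p_a-1}\big(x^p_{\sigma_p(a)}-x^{p+1}_{\sigma_{p+1}(i)}\big)\cdot h\cdot\prod_{i=\widetilde I^p_a+1}^{k_{p+1}}\big(x^p_{\sigma_p(a)}-x^{p+1}_{\sigma_{p+1}(i)}+h\big)\Bigg)\prod_{1\le a<b\le k_p}\frac{x^p_{\sigma_p(a)}-x^p_{\sigma_p(b)}-h}{x^p_{\sigma_p(a)}-x^p_{\sigma_p(b)}}\Bigg\}.$$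 Theorem. Let $\overline x^1,\dots,\overline x^N$ be pairwise disjoint finite (possibly empty) sets of indeterminates. Then, in the algebra obtained from formal power series over $Y_h(\mathfrak{gl}_N)$ in the inverses of all these indeterminates by adjoining the rational functions of the indeterminates as scalars, $$\begin{aligned}T_{N1}(\overline x^1)T_{N2}(\overline x^2)\cdots T_{NN}(\overline x^N)=\sum&\ \frac{1}{\prod_{1\le j<k\le N}(\overline y^k-\overline y^j)(\overline y^j-\overline y^{k-1}+h)}\\&\times\frac{\prod_{j=1}^{N-1}(\overline x^N-\overline y^j+h)}{\prod_{j=1}^{N-1}(\overline x^j-\overline y^N+h)\ \prod_{\ell=1}^{N-2}\prod_{j=1}^{\ell}\prod_{k=1}^{\ell+1}(\overline x^j-\overline x^k+h)}\\&\times W\big(\overline x^1,\overline x^1\cup\overline x^2,\dots,\overline x^1\cup\cdots\cup\overline x^{N-1}\,\big|\,\overline y^1,\dots,\overline y^N\,\big|\,1^{|\overline x^1|},2^{|\overline x^2|},\dots,N^{|\overline x^N|}\big)\\&\times T_{NN}(\overline y^N)\cdots T_{N2}(\overline y^2)T_{N1}(\overline y^1),\end{aligned}$$ where the sum is over all partitions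 of $\overline x^1\cup\cdots\cup\overline x^N$ into subsets $\overline y^1,\dots,\overline y^N$ with $|\overline y^j|=|\overline x^j|$ for all $j$, where $j^m$ means that the colour $j$ is repeated $m$ times, and where the elements of each $\overline y^j$ may be listed in any order. -/

import Mathlib

open scoped TensorProduct Kronecker

noncomputable section

namespace YangianCommutation

/-! ### The Yangian -/

/-- The series `∑ r, f r * t_a ^ r` in the variable `t_a`, as a formal power series in the family
of central variables `t_s`, `s : σ`, with coefficients in `A`. -/
def seriesIn {σ A : Type*} [Semiring A] (a : σ) (f : ℕ → A) : MvPowerSeries σ A :=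
  open Classical in fun d => if d = Finsupp.single a (d a) then f (d a) else 0

/-- The rational `R`-matrix
`(d + h) ∑ E_ii ⊗ E_ii + d ∑_{i ≠ j} E_ii ⊗ E_jj + h ∑_{i ≠ j} E_ij ⊗ E_ji`;
the matrix `R(x, y)` is `rMatrix N (x - y) h`. -/
def rMatrix (N : ℕ) {S : Type*} [Ring S] (d h : S) :
    Matrix (Fin N × Fin N) (Fin N × Fin N) S :=
  (d + h) • (∑ i, Matrix.single i i (1 : S) ⊗ₖ Matrix.single i i (1 : S)) +
  d • (∑ i, ∑ j with i ≠ j, Matrix.single i i (1 : S) ⊗ₖ Matrix.single j j (1 : S)) +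
  h • (∑ i, ∑ j with i ≠ j, Matrix.single i j (1 : S) ⊗ₖ Matrix.single j i (1 : S))

/-- The free unital algebra on symbols `T_ij[r]`, encoded as `(i, j, r)`. -/
abbrev FreeGen (N : ℕ) : Type := FreeAlgebra ℂ (Fin N × Fin N × ℕ)

/-- The matrix `T(x_a)` of series `∑ r, T_ij[r] x_a ^ (-r)` over the free algebra, for two
spectral parameters `x_0 = x`, `x_1 = y`; the variable `X a` stands for `x_a⁻¹`. -/
def freeT (N : ℕ) (a : Fin 2) :
    Matrix (Fin N) (Fin N) (MvPowerSeries (Fin 2) (FreeGen N)) :=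
  Matrix.of fun i j => seriesIn a fun r => FreeAlgebra.ι ℂ (i, j, r)

/-- The rational `R`-matrix multiplied by `x⁻¹ y⁻¹`, which makes its entries power series in
`x⁻¹ = X 0` and `y⁻¹ = X 1`: `x⁻¹ y⁻¹ (x - y) = y⁻¹ - x⁻¹` and `h` becomes `h x⁻¹ y⁻¹`. -/
def scaledR (N : ℕ) (h : ℂ) :
    Matrix (Fin N × Fin N) (Fin N × Fin N) (MvPowerSeries (Fin 2) (FreeGen N)) :=
  rMatrix N (MvPowerSeries.X 1 - MvPowerSeries.X 0)
    (h • (MvPowerSeries.X 0 * MvPowerSeries.X 1))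

/-- `T_1(x) = T(x) ⊗ 1`. -/
def freeT₁ (N : ℕ) :
    Matrix (Fin N × Fin N) (Fin N × Fin N) (MvPowerSeries (Fin 2) (FreeGen N)) :=
  freeT N 0 ⊗ₖ (1 : Matrix (Fin N) (Fin N) _)

/-- `T_2(y) = 1 ⊗ T(y)`. -/
def freeT₂ (N : ℕ) :
    Matrix (Fin N × Fin N) (Fin N × Fin N) (MvPowerSeries (Fin 2) (FreeGen N)) :=
  (1 : Matrix (Fin N) (Fin N) _) ⊗ₖ freeT N 1

/-- The defining relations of the Yangian: all coefficients of all matrix entries of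
`R(x, y) T_1(x) T_2(y) = T_2(y) T_1(x) R(x, y)`. -/
inductive Rel (N : ℕ) (h : ℂ) : FreeGen N → FreeGen N → Prop
  | rtt (p q : Fin N × Fin N) (d : Fin 2 →₀ ℕ) :
      Rel N h
        (MvPowerSeries.coeff d ((scaledR N h * freeT₁ N * freeT₂ N) p q))
        (MvPowerSeries.coeff d ((freeT₂ N * freeT₁ N * scaledR N h) p q))

/-- The Yangian `Y_h(gl_N)`. -/
abbrev Yangian (N : ℕ) (h : ℂ) : Type := RingQuot (Rel N h)

/-- The generator `T_ij[r]` of the Yangian. -/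
def gen {N : ℕ} (h : ℂ) (i j : Fin N) (r : ℕ) : Yangian N h :=
  RingQuot.mkAlgHom ℂ (Rel N h) (FreeAlgebra.ι ℂ (i, j, r))

/-! ### Several spectral parameters

The spectral parameters `x_s`, `s : σ`, are indeterminates. The variables of the polynomials and
power series below are `t_s = x_s⁻¹`. -/

/-- The field `ℂ(x_s : s ∈ σ)` of rational functions, written as the fraction field of the
polynomial ring in the variables `x_s⁻¹`. -/
abbrev RatFun (σ : Type) : Type := FractionRing (MvPolynomial σ ℂ)

/-- The spectral parameter `x_s`. -/
def spec {σ : Type} (s : σ) : RatFun σ :=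
  (algebraMap (MvPolynomial σ ℂ) (RatFun σ) (MvPolynomial.X s))⁻¹

/-- A polynomial in the `x_s⁻¹` seen as a power series over the Yangian. -/
def polyToSeries (σ : Type) (N : ℕ) (h : ℂ) :
    MvPolynomial σ ℂ →+* MvPowerSeries σ (Yangian N h) :=
  (MvPowerSeries.map (algebraMap ℂ (Yangian N h))).comp MvPolynomial.coeToMvPowerSeries.ringHom

theorem polyToSeries_comm (σ : Type) (N : ℕ) (h : ℂ) (p : MvPolynomial σ ℂ)
    (f : MvPowerSeries σ (Yangian N h)) :
    polyToSeries σ N h p * f = f * polyToSeries σ N h p := by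
  classical
  ext d
  rw [MvPowerSeries.coeff_mul, MvPowerSeries.coeff_mul]
  refine Finset.sum_nbij' Prod.swap Prod.swap ?_ ?_ ?_ ?_ ?_
  · intro i hi
    simpa [add_comm] using hi
  · intro i hi
    simpa [add_comm] using hi
  · intro i _
    rfl
  · intro i _
    rfl
  · intro i _
    simp [polyToSeries, Algebra.commutes]

instance seriesAlgebra (σ : Type) (N : ℕ) (h : ℂ) :
    Algebra (MvPolynomial σ ℂ) (MvPowerSeries σ (Yangian N h)) :=
  (polyToSeries σ N h).toAlgebra' (polyToSeries_comm σ N h)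

/-- Power series in the `x_s⁻¹` over the Yangian, with rational functions of the `x_s` adjoined
as scalars. -/
abbrev SpecAlg (σ : Type) (N : ℕ) (h : ℂ) : Type :=
  RatFun σ ⊗[MvPolynomial σ ℂ] MvPowerSeries σ (Yangian N h)

/-- The element `T_ij(x_s) = ∑ r, T_ij[r] x_s ^ (-r)`. -/
def T {σ : Type} {N : ℕ} (h : ℂ) (i j : Fin N) (s : σ) : SpecAlg σ N h :=
  1 ⊗ₜ[MvPolynomial σ ℂ] seriesIn s (gen h i j)

/-! ### The rational weight functions -/

/-- The coordinates of colour at most `p` (colours and layers are numbered from `0`), with the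
order inherited from `ι`. -/
abbrev Layer {M : ℕ} {ι : Type*} (I : ι → Fin (M + 1)) (p : Fin (M + 1)) : Type _ :=
  {i : ι // I i ≤ p}

/-- The variables of all layers: those of the layer `p < M` are permuted by `σ p`, those of the
last layer are `y`. -/
def layerVar {M : ℕ} {ι K : Type*} (I : ι → Fin (M + 1))
    (x : ∀ p : Fin M, Layer I p.castSucc → K) (y : ι → K)
    (σ : ∀ p : Fin M, Equiv.Perm (Layer I p.castSucc)) :
    ∀ p : Fin (M + 1), Layer I p → K :=
  Fin.lastCases (motive := fun p => Layer I p → K)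
    (fun i => y i.1) (fun p a => x p (σ p a))

/-- The rational weight function `W(x^1, …, x^M | y | I)` for `N = M + 1` colours.

The coordinates form a finite linear order `ι` (for instance `Fin L`) and are coloured by `I`.
The number of variables in the `p`-th layer is the number of coordinates in `Layer I p`, and the
variables are labelled by these coordinates, in increasing order. With this labelling the relative
position of `Layer I p` inside `Layer I (p + 1)` is the inclusion, so the position of `a` in the
next layer is `a` itself. -/
def weight {M : ℕ} {ι K : Type*} [Fintype ι] [LinearOrder ι] [Field K] (h : K)
    (I : ι → Fin (M + 1)) (x : ∀ p : Fin M, Layer I p.castSucc → K) (y : ι → K) : K :=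
  ∑ σ : ∀ p : Fin M, Equiv.Perm (Layer I p.castSucc),
    ∏ p : Fin M,
      ((∏ a : Layer I p.castSucc,
          ((∏ i : Layer I p.succ with i.1 < a.1,
              (layerVar I x y σ p.castSucc a - layerVar I x y σ p.succ i)) *
            h *
            ∏ i : Layer I p.succ with a.1 < i.1,
              (layerVar I x y σ p.castSucc a - layerVar I x y σ p.succ i + h))) *
        ∏ a : Layer I p.castSucc, ∏ b : Layer I p.castSucc with a < b,
          (layerVar I x y σ p.castSucc a - layerVar I x y σ p.castSucc b - h) /
            (layerVar I x y σ p.castSucc a - layerVar I x y σ p.castSucc b))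

/-! ### Partitions and coefficients -/

/-- The labels of the variables in the blocks `x^j`, where `n j` is the size of `x^j`. -/
abbrev Var {M : ℕ} (n : Fin (M + 1) → ℕ) : Type := Σ j, Fin (n j)

/-- Partitions of the set of all variables into blocks `Y j` with `n j` elements. -/
def VarPartition {M : ℕ} (n : Fin (M + 1) → ℕ) : Type :=
  {Y : Fin (M + 1) → Finset (Var n) // (∀ j, (Y j).card = n j) ∧ ∀ s, ∃! j, s ∈ Y j}

instance {M : ℕ} (n : Fin (M + 1) → ℕ) : Fintype (VarPartition n) :=
  open Classical in inferInstanceAs (Fintype {Y : Fin (M + 1) → Finset (Var n) //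
    (∀ j, (Y j).card = n j) ∧ ∀ s, ∃! j, s ∈ Y j})

/-- `∏_{a, b} (u_a - v_b + c)`. -/
def diffProd {α β K : Type*} [Fintype α] [Fintype β] [Field K] (c : K) (u : α → K) (v : β → K) :
    K :=
  ∏ a, ∏ b, (u a - v b + c)

/-- The elementary factor
`∏_{j<k} 1 / ((y^k - y^j) (y^j - y^{k-1} + h)) * ∏_{j<N} (x^N - y^j + h) /
 (∏_{j<N} (x^j - y^N + h) ∏_{ℓ=1}^{N-2} ∏_{j=1}^{ℓ} ∏_{k=1}^{ℓ+1} (x^j - x^k + h))`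
with `N = M + 1`. Blocks are numbered from `0`; the pair `k - 1, k` is `k.castSucc, k.succ`, and
the index `ℓ = 0` in the last product contributes `1`. -/
def prefactor {M : ℕ} {K : Type*} [Field K] (h : K) {n : Fin (M + 1) → ℕ}
    (x y : ∀ j, Fin (n j) → K) : K :=
  (∏ k : Fin M, ∏ j ∈ Finset.Iic k.castSucc,
      diffProd 0 (y k.succ) (y j) * diffProd h (y j) (y k.castSucc))⁻¹ *
    ((∏ j : Fin M, diffProd h (x (Fin.last M)) (y j.castSucc)) /
      ((∏ j : Fin M, diffProd h (x j.castSucc) (y (Fin.last M))) *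
        ∏ l : Fin M, ∏ j ∈ Finset.Iio l.castSucc, ∏ k ∈ Finset.Iic l.castSucc,
          diffProd h (x j) (x k)))

/-- The specialization
`W(x^1, x^1 ∪ x^2, …, x^1 ∪ ⋯ ∪ x^M | y^1, …, y^N | 1^{n_1}, 2^{n_2}, …, N^{n_N})`, `N = M + 1`.
The coordinates are the pairs `(j, a)` in lexicographic order, and `(j, a)` has colour `j`. -/
def specialWeight {M : ℕ} {K : Type*} [Field K] (h : K) {n : Fin (M + 1) → ℕ}
    (x y : ∀ j, Fin (n j) → K) : K :=
  weight (ι := Σₗ j, Fin (n j)) h (fun s => (ofLex s).1)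
    (fun _ s => x (ofLex s.1).1 (ofLex s.1).2) (fun s => y (ofLex s).1 (ofLex s).2)

end YangianCommutation

end

open YangianCommutation

namespace YangianCommutation

/-- A function of two variables extended to optional arguments by `1`. -/
def optMap₂ {U K : Type*} [One K] (f : U → U → K) : Option U → Option U → K
  | some a, some b => f a b
  | _, _ => 1

/-- The contribution to a layer of the weight function of a pair of positions `d < e`; the first
component is the variable of the outer layer, the second one that of the inner layer, if any. -/
def pairFactor {U K : Type*} [Field K] (h : K) (x : U → K) (d e : Option U × Option U) : K :=
  optMap₂ (fun v t => x t - x v) d.1 e.2 * optMap₂ (fun t v => x t - x v + h) d.2 e.1 *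
    optMap₂ (fun t t' => (x t - x t' - h) / (x t - x t')) d.2 e.2

/-- The product of a function over all increasing pairs. -/
def pairProd {ι D K : Type*} [Fintype ι] [LinearOrder ι] [CommMonoid K] (P : D → D → K)
    (d : ι → D) : K :=
  ∏ i, ∏ j, if i < j then P (d i) (d j) else 1

/-- The partial labellings of the positions of colour at most `m` by the variables of colour at
most `m`. -/
def IsLayer {ι U : Type*} (κ : U → ℕ) (I : ι → ℕ) (m : ℕ) (σ : ι → Option U) : Prop :=
  (∀ i, σ i ≠ none ↔ I i ≤ m) ∧ (∀ u, κ u ≤ m ↔ ∃ i, σ i = some u) ∧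
    ∀ i j u, σ i = some u → σ j = some u → i = j

open Classical in
/-- The weight function with `m` layers, defined by recursion on the number of layers. -/
noncomputable def layerWeight {ι U K : Type*} [Fintype ι] [LinearOrder ι] [Fintype U] [Field K]
    (h : K) (x : U → K) (κ : U → ℕ) (I : ι → ℕ) : ℕ → (ι → Option U) → K
  | 0, _ => 1
  | m + 1, z => ∑ σ : ι → Option U, if IsLayer κ I m σ then
      h ^ Fintype.card {u // κ u ≤ m} * pairProd (pairFactor h x) (fun i => (z i, σ i)) *
        layerWeight h x κ I m σ else 0

@[to_additive]
theorem prod_eq_mul_mul_prod_compl {ι K : Type*} [Fintype ι] [DecidableEq ι] [CommMonoid K]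
    (f : ι → K) {a b : ι} (hab : a ≠ b) :
    ∏ i, f i = f a * f b * ∏ i ∈ ({a, b} : Finset ι)ᶜ, f i := by
  rw [← Finset.prod_pair hab, Finset.prod_mul_prod_compl]

section pairProd

variable {ι D K : Type*} [Fintype ι] [LinearOrder ι] [CommMonoid K]

theorem exists_pairProd_eq_mul (P : D → D → K) (d : ι → D) {a b : ι} (hab : a ⋖ b) :
    ∃ R, ∀ d' : ι → D, (∀ c, c ≠ a → c ≠ b → d' c = d c) →
      (∀ e, P e (d' a) * P e (d' b) = P e (d a) * P e (d b)) →
      (∀ e, P (d' a) e * P (d' b) e = P (d a) e * P (d b) e) →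
      pairProd P d' = P (d' a) (d' b) * R := by
  have hlt : ∀ c, c ≠ a → c ≠ b → (c < a ↔ c < b) := fun c h1 h2 =>
    ⟨fun h => h.trans hab.1, fun h => lt_of_le_of_ne (hab.le_of_lt h) h1⟩
  have hgt : ∀ c, c ≠ a → c ≠ b → (a < c ↔ b < c) := fun c h1 h2 =>
    ⟨fun h => lt_of_le_of_ne (hab.ge_of_gt h) h2.symm, fun h => hab.1.trans h⟩
  have key : ∀ d : ι → D, pairProd P d = P (d a) (d b) *
      ((∏ j ∈ ({a, b} : Finset ι)ᶜ, if a < j then P (d a) (d j) * P (d b) (d j) else 1) *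
      ∏ i ∈ ({a, b} : Finset ι)ᶜ, ((if i < a then P (d i) (d a) * P (d i) (d b) else 1) *
        ∏ j ∈ ({a, b} : Finset ι)ᶜ, if i < j then P (d i) (d j) else 1)) := by
    intro d
    unfold pairProd
    rw [prod_eq_mul_mul_prod_compl _ hab.1.ne, prod_eq_mul_mul_prod_compl _ hab.1.ne,
      prod_eq_mul_mul_prod_compl (fun j => if b < j then P (d b) (d j) else 1) hab.1.ne]
    simp only [lt_irrefl, if_false, hab.1, if_true, hab.1.not_gt, one_mul, mul_one]
    rw [mul_assoc, mul_assoc, ← mul_assoc (∏ j ∈ _, _), ← Finset.prod_mul_distrib]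
    congr 2
    · refine Finset.prod_congr rfl fun j hj => ?_
      simp only [Finset.mem_compl, Finset.mem_insert, Finset.mem_singleton, not_or] at hj
      simp only [← hgt j hj.1 hj.2]
      split_ifs <;> simp
    · refine Finset.prod_congr rfl fun j hj => ?_
      simp only [Finset.mem_compl, Finset.mem_insert, Finset.mem_singleton, not_or] at hj
      rw [prod_eq_mul_mul_prod_compl _ hab.1.ne]
      simp only [← hlt j hj.1 hj.2]
      split_ifs <;> simp
  refine ⟨(∏ j ∈ ({a, b} : Finset ι)ᶜ, if a < j then P (d a) (d j) * P (d b) (d j) else 1) *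
      ∏ i ∈ ({a, b} : Finset ι)ᶜ, ((if i < a then P (d i) (d a) * P (d i) (d b) else 1) *
        ∏ j ∈ ({a, b} : Finset ι)ᶜ, if i < j then P (d i) (d j) else 1),
    fun d' hd hl hr => (key d').trans ?_⟩
  have hd' : ∀ j ∈ ({a, b} : Finset ι)ᶜ, d' j = d j := fun j hj => by
    simp only [Finset.mem_compl, Finset.mem_insert, Finset.mem_singleton, not_or] at hj
    exact hd j hj.1 hj.2
  congr 2
  · exact Finset.prod_congr rfl fun j hj => by rw [hr, hd' j hj]
  · refine Finset.prod_congr rfl fun j hj => ?_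
    rw [hl, hd' j hj]
    congr 1
    exact Finset.prod_congr rfl fun i hi => by rw [hd' i hi]

end pairProd

theorem IsLayer.comp_iff {ι ι' U : Type*} {κ : U → ℕ} {I : ι → ℕ} {m : ℕ} {σ : ι → Option U} (e : ι' ≃ ι) :
    IsLayer κ (I ∘ e) m (σ ∘ e) ↔ IsLayer κ I m σ := by
  unfold IsLayer
  refine and_congr ?_ (and_congr ?_ ?_)
  · exact (e.surjective.forall (p := fun i => σ i ≠ none ↔ I i ≤ m)).symm
  · simp [e.surjective.exists]
  · constructor
    · intro H i j u hi hj
      simpa using H (e.symm i) (e.symm j) u (by simpa using hi) (by simpa using hj)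
    · intro H i j u hi hj
      exact e.injective (H _ _ u hi hj)

theorem sum_comp_swap {ι D V : Type*} [Fintype (ι → D)] [DecidableEq ι] [AddCommMonoid V]
    (a b : ι) (G : (ι → D) → V) :
    ∑ σ : ι → D, G (σ ∘ Equiv.swap a b) = ∑ σ : ι → D, G σ :=
  Fintype.sum_equiv (Equiv.arrowCongr (Equiv.swap a b) (Equiv.refl D)) _ _ fun _ => rfl

section exchange

variable {ι U K : Type*} [Fintype ι] [LinearOrder ι] [Field K]
  (h : K) (x : U → K)

theorem exists_pairProd_pairFactor_eq_mul (z σ : ι → Option U) {a b : ι} (hab : a ⋖ b) :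
    ∃ R, ∀ z' σ' : ι → Option U, (z' = z ∨ z' = z ∘ Equiv.swap a b) →
      (σ' = σ ∨ σ' = σ ∘ Equiv.swap a b) →
      pairProd (pairFactor h x) (fun i => (z' i, σ' i)) =
        pairFactor h x (z' a, σ' a) (z' b, σ' b) * R := by
  obtain ⟨R, hR⟩ := exists_pairProd_eq_mul (pairFactor h x) (fun i => (z i, σ i)) hab
  refine ⟨R, fun z' σ' hz hσ => hR _ (fun c h1 h2 => ?_) (fun e => ?_) (fun e => ?_)⟩
  · rcases hz with rfl | rfl <;> rcases hσ with rfl | rfl <;>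
      simp [Equiv.swap_apply_of_ne_of_ne h1 h2]
  all_goals
    rcases hz with rfl | rfl <;> rcases hσ with rfl | rfl <;> simp [pairFactor] <;> ring

variable [Fintype U] (κ : U → ℕ)

theorem layerWeight_comp_swap {a b : ι} (hab : a ⋖ b) (I : ι → ℕ) : ∀ (m : ℕ) (z : ι → Option U),
    (z a = none ∧ m ≤ I a) ∨ (z b = none ∧ m ≤ I b) →
    layerWeight h x κ (I ∘ Equiv.swap a b) m (z ∘ Equiv.swap a b) = layerWeight h x κ I m z
  | 0, z, _ => rfl
  | m + 1, z, hz => by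
    classical
    rw [layerWeight, layerWeight, ← sum_comp_swap a b]
    refine Finset.sum_congr rfl fun σ _ => ?_
    simp only [IsLayer.comp_iff]
    split_ifs with hσ
    · have hσ' : (z a = none ∧ σ a = none ∧ m ≤ I a) ∨ (z b = none ∧ σ b = none ∧ m ≤ I b) := by
        refine hz.imp (fun H => ⟨H.1, ?_, by omega⟩) (fun H => ⟨H.1, ?_, by omega⟩)
        · by_contra h1
          have := (hσ.1 a).1 h1
          omega
        · by_contra h1
          have := (hσ.1 b).1 h1
          omega
      rw [layerWeight_comp_swap hab I m σ (hσ'.imp And.right And.right)]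
      congr 2
      obtain ⟨R, hR⟩ := exists_pairProd_pairFactor_eq_mul h x z σ hab
      rw [hR _ _ (Or.inl rfl) (Or.inl rfl), hR _ _ (Or.inr rfl) (Or.inr rfl)]
      rcases hσ' with H | H <;> simp [pairFactor, optMap₂, H]
    · rfl

omit [Fintype ι] [LinearOrder ι] [Fintype U] in
theorem weight_pair_identity {z₁ z₂ t₁ t₂ w₁ w₂ w₃ w₄ : K} (ht : t₁ ≠ t₂)
    (e₁ : (t₁ - t₂ - h) * w₁ = (t₁ - t₂) * w₂ - h * w₃)
    (e₂ : (t₂ - t₁ - h) * w₃ = (t₂ - t₁) * w₄ - h * w₁) :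
    (z₁ - z₂ - h) * ((t₂ - z₁) * (t₁ - z₂ + h) * ((t₁ - t₂ - h) / (t₁ - t₂)) * w₁) -
      ((z₁ - z₂) * ((t₁ - z₂) * (t₂ - z₁ + h) * ((t₂ - t₁ - h) / (t₂ - t₁)) * w₂) -
        h * ((t₂ - z₂) * (t₁ - z₁ + h) * ((t₁ - t₂ - h) / (t₁ - t₂)) * w₁)) +
    ((z₁ - z₂ - h) * ((t₁ - z₁) * (t₂ - z₂ + h) * ((t₂ - t₁ - h) / (t₂ - t₁)) * w₃) -
      ((z₁ - z₂) * ((t₂ - z₂) * (t₁ - z₁ + h) * ((t₁ - t₂ - h) / (t₁ - t₂)) * w₄) -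
        h * ((t₁ - z₂) * (t₂ - z₁ + h) * ((t₂ - t₁ - h) / (t₂ - t₁)) * w₃))) = 0 := by
  have h1 : t₁ - t₂ ≠ 0 := sub_ne_zero.2 ht
  have h2 : t₂ - t₁ ≠ 0 := sub_ne_zero.2 ht.symm
  have hw₂ : w₂ = ((t₁ - t₂ - h) * w₁ + h * w₃) / (t₁ - t₂) := by
    rw [eq_div_iff h1, e₁]; ring
  have hw₄ : w₄ = ((t₂ - t₁ - h) * w₃ + h * w₁) / (t₂ - t₁) := by
    rw [eq_div_iff h2, e₂]; ring
  have h3 : t₂ - t₁ = -(t₁ - t₂) := by ring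
  rw [hw₂, hw₄, h3]
  field_simp
  ring

theorem layerWeight_exchange (hx : Function.Injective x) {a b : ι} (hab : a ⋖ b) (I : ι → ℕ) :
    ∀ (m : ℕ) (z : ι → Option U) (u v : U), z a = some u → z b = some v →
    (x u - x v - h) * layerWeight h x κ I m z =
      (x u - x v) * layerWeight h x κ (I ∘ Equiv.swap a b) m (z ∘ Equiv.swap a b) -
        h * layerWeight h x κ I m (z ∘ Equiv.swap a b)
  | 0, z, u, v, _, _ => by simp [layerWeight]
  | m + 1, z, u, v, hu, hv => by
    classical
    have hne : a ≠ b := hab.1.ne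
    rw [layerWeight, layerWeight, layerWeight,
      ← sum_comp_swap a b fun σ => if IsLayer κ (I ∘ Equiv.swap a b) m σ then _ else 0]
    simp only [IsLayer.comp_iff]
    rw [← sub_eq_zero, Finset.mul_sum, Finset.mul_sum, Finset.mul_sum, ← Finset.sum_sub_distrib,
      ← Finset.sum_sub_distrib]
    have hss : ∀ f : ι → Option U, (f ∘ Equiv.swap a b) ∘ Equiv.swap a b = f := fun f => by
      ext; simp
    by_cases hm : I a ≤ m ∧ I b ≤ m
    · refine Finset.sum_involution (fun σ _ => σ ∘ Equiv.swap a b) (fun σ _ => ?_)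
        (fun σ _ h0 => ?_) (fun _ _ => Finset.mem_univ _) (fun σ _ => ?_)
      · have hI : IsLayer κ I m (σ ∘ Equiv.swap a b) ↔ IsLayer κ I m σ := by
          rw [← IsLayer.comp_iff (I := I) (Equiv.swap a b)]
          have : ∀ i, (I ∘ Equiv.swap a b) i ≤ m ↔ I i ≤ m := fun i => by
            by_cases h1 : i = a
            · simp [h1, hm]
            · by_cases h2 : i = b
              · simp [h2, hm]
              · simp [Equiv.swap_apply_of_ne_of_ne h1 h2]
          rw [hss]
          simp only [IsLayer, this]
        simp only [hI]
        split_ifs with hσ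
        · obtain ⟨t₁, h₁⟩ := Option.ne_none_iff_exists'.1 ((hσ.1 a).2 hm.1)
          obtain ⟨t₂, h₂⟩ := Option.ne_none_iff_exists'.1 ((hσ.1 b).2 hm.2)
          have ht : x t₁ ≠ x t₂ := fun h0 => hne (hσ.2.2 a b t₁ h₁ (hx h0 ▸ h₂))
          have e₁ := layerWeight_exchange hx hab I m σ t₁ t₂ h₁ h₂
          have e₂ := layerWeight_exchange hx hab I m (σ ∘ Equiv.swap a b) t₂ t₁
            (by simpa using h₂) (by simpa using h₁)
          obtain ⟨R, hR⟩ := exists_pairProd_pairFactor_eq_mul h x z σ hab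
          rw [hss] at e₂ ⊢
          rw [hR _ _ (Or.inl rfl) (Or.inl rfl), hR _ _ (Or.inr rfl) (Or.inr rfl),
            hR _ _ (Or.inl rfl) (Or.inr rfl), hR _ _ (Or.inr rfl) (Or.inl rfl)]
          have := weight_pair_identity h (z₁ := x u) (z₂ := x v) ht e₁ e₂
          simp [pairFactor, optMap₂, hu, hv, h₁, h₂]
          linear_combination (h ^ Fintype.card {u // κ u ≤ m} * R) * this
        · simp
      · contrapose! h0
        rw [if_neg, if_neg, if_neg]
        · simp
        all_goals
        · intro hσ
          obtain ⟨t₁, h₁⟩ := Option.ne_none_iff_exists'.1 ((hσ.1 a).2 hm.1)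
          have := congrFun h0 a
          exact hne (hσ.2.2 a b t₁ h₁ (by simpa [h₁] using this))
      · ext; simp
    · refine Finset.sum_eq_zero fun σ _ => ?_
      split_ifs with hσ
      · rw [layerWeight_comp_swap h x κ hab I m σ (by
          rcases not_and_or.1 hm with H | H
          · exact Or.inl ⟨by_contra fun h0 => H ((hσ.1 a).1 h0), by omega⟩
          · exact Or.inr ⟨by_contra fun h0 => H ((hσ.1 b).1 h0), by omega⟩)]
        obtain ⟨R, hR⟩ := exists_pairProd_pairFactor_eq_mul h x z σ hab
        rw [hR _ _ (Or.inl rfl) (Or.inl rfl), hR _ _ (Or.inr rfl) (Or.inr rfl),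
            hR _ _ (Or.inr rfl) (Or.inl rfl)]
        rcases not_and_or.1 hm with H | H
        · have h₁ : σ a = none := by_contra fun h0 => H ((hσ.1 a).1 h0)
          rcases h₂ : σ b with _ | t <;> simp [pairFactor, optMap₂, hu, hv, h₁, h₂] <;> ring
        · have h₁ : σ b = none := by_contra fun h0 => H ((hσ.1 b).1 h0)
          rcases h₂ : σ a with _ | t <;> simp [pairFactor, optMap₂, hu, hv, h₁, h₂] <;> ring
      · simp

end exchange
theorem eq_self_of_injOn_of_le {ι : Type*} [Finite ι] [LinearOrder ι] (T : ι → Prop) (g : ι → ι)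
    (hT : ∀ j, T j → T (g j)) (hg : ∀ i j, T i → T j → g i = g j → i = j)
    (hle : ∀ j, T j → g j ≤ j) (j : ι) (hj : T j) : g j = j := by
  induction j using WellFoundedLT.induction with
  | ind j ih =>
    rcases (hle j hj).lt_or_eq with h | h
    · exact hg _ _ (hT j hj) hj (ih _ h (hT j hj))
    · exact h

theorem prod_prod_eq_prod_mul_pairProd {ι K : Type*} [Fintype ι] [LinearOrder ι] [CommMonoid K]
    (g : ι → ι → K) :
    ∏ i, ∏ j, g i j = (∏ i, g i i) * pairProd (fun i j => g i j * g j i) id := by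
  have h1 : ∀ i j, g i j = (if i = j then g i j else 1) * (if i < j then g i j else 1) *
      (if j < i then g i j else 1) := fun i j => by
    rcases lt_trichotomy i j with h | h | h
    · simp [h, h.ne, h.not_gt]
    · simp [h]
    · simp [h, h.ne', h.not_gt]
  have h2 : ∏ i, ∏ j, (if j < i then g i j else 1) = ∏ i, ∏ j, if i < j then g j i else 1 :=
    Finset.prod_comm
  have h3 : ∀ i j, (if i < j then g i j * g j i else 1) =
      (if i < j then g i j else 1) * (if i < j then g j i else 1) := fun i j => by
    split_ifs <;> simp
  calc ∏ i, ∏ j, g i j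
      = ∏ i, ∏ j, (if i = j then g i j else 1) * (if i < j then g i j else 1) *
          (if j < i then g i j else 1) :=
        Finset.prod_congr rfl fun i _ => Finset.prod_congr rfl fun j _ => h1 i j
    _ = _ := by
      simp only [Finset.prod_mul_distrib, pairProd, id, h3, h2, mul_assoc]
      congr 1
      simp

/-- The restriction of a labelling to the positions of colour at most `m`. -/
def restrictColor {ι U : Type*} (I : ι → ℕ) (z : ι → U) (m : ℕ) (i : ι) : Option U :=
  if I i ≤ m then some (z i) else none

section delta

variable {ι U K : Type*} [Fintype ι] [LinearOrder ι] [Fintype U] [Field K]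
  (h : K) (x : U → K) (κ : U → ℕ)

omit [Fintype ι] [LinearOrder ι] [Fintype U] in
theorem isLayer_restrictColor_iff (I : ι → ℕ) (z : ι ≃ U) (m : ℕ) :
    IsLayer κ I m (restrictColor I z m) ↔ ∀ i, κ (z i) ≤ m ↔ I i ≤ m := by
  unfold IsLayer restrictColor
  constructor
  · rintro ⟨-, h2, -⟩ i
    rw [h2]
    constructor
    · rintro ⟨j, hj⟩
      split_ifs at hj with h3
      simp only [Option.some.injEq, EmbeddingLike.apply_eq_iff_eq] at hj
      exact hj ▸ h3
    · intro h3
      exact ⟨i, by simp [h3]⟩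
  · intro H
    refine ⟨fun i => by simp, fun u => ?_, fun i j u hi hj => ?_⟩
    · have := H (z.symm u)
      rw [Equiv.apply_symm_apply] at this
      rw [this]
      constructor
      · exact fun h3 => ⟨_, by rw [if_pos h3]; simp⟩
      · rintro ⟨j, hj⟩
        split_ifs at hj with h3
        simp only [Option.some.injEq] at hj
        simpa [← hj] using h3
    · split_ifs at hi hj
      simp only [Option.some.injEq] at hi hj
      exact z.injective (hi.trans hj.symm)

omit [Fintype U] in
theorem eq_restrictColor_of_pairProd_ne_zero {I : ι → ℕ} {z : ι ≃ U}
    (hord : Monotone (κ ∘ z) ∨ Antitone I) {m : ℕ}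
    (hm : ∀ i, κ (z i) ≤ m + 1 ↔ I i ≤ m + 1) {σ : ι → Option U} (hσ : IsLayer κ I m σ)
    (hne : pairProd (pairFactor h x) (fun i => (restrictColor I z (m + 1) i, σ i)) ≠ 0) :
    σ = restrictColor I z m := by
  have hle : ∀ c j, σ c = some (z j) → c ≤ j := by
    intro c j hc
    by_contra! hlt
    refine hne (Finset.prod_eq_zero (Finset.mem_univ j) (Finset.prod_eq_zero (Finset.mem_univ c) ?_))
    have h1 : I j ≤ m + 1 := (hm j).1 (((hσ.2.1 (z j)).2 ⟨c, hc⟩).trans m.le_succ)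
    rw [if_pos hlt]
    simp [pairFactor, optMap₂, restrictColor, h1, hc]
  have hnone : ∀ c, ¬ I c ≤ m → σ c = none := fun c hc => by_contra fun h0 => hc ((hσ.1 c).1 h0)
  suffices H : ∀ c, I c ≤ m → σ c = some (z c) by
    ext1 c
    by_cases hc : I c ≤ m
    · simp [restrictColor, hc, H c hc]
    · simp [restrictColor, hc, hnone c hc]
  rcases hord with hord | hord
  · have h1 : ∀ j, ∃ c, κ (z j) ≤ m → σ c = some (z j) := fun j => by
      by_cases hj : κ (z j) ≤ m
      · exact ((hσ.2.1 (z j)).1 hj).imp fun c hc _ => hc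
      · exact ⟨j, fun h0 => absurd h0 hj⟩
    choose g hg using h1
    have h2 := eq_self_of_injOn_of_le (fun j => κ (z j) ≤ m) g
      (fun j hj => (hord (hle _ _ (hg j hj))).trans hj)
      (fun i j hi hj hij => by
        have := hg i hi
        rw [hij, hg j hj] at this
        simpa using this.symm)
      (fun j hj => hle _ _ (hg j hj))
    intro c hc
    obtain ⟨t, ht⟩ := Option.ne_none_iff_exists'.1 ((hσ.1 c).2 hc)
    have hκ : κ t ≤ m := (hσ.2.1 t).2 ⟨c, ht⟩
    have h3 := hg (z.symm t) (by simpa using hκ)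
    rw [h2 _ (by simpa using hκ)] at h3
    have h4 := hσ.2.2 c _ t ht (by simpa using h3)
    rw [ht, h4]
    simp
  · have h1 : ∀ c, ∃ j, I c ≤ m → σ c = some (z j) := fun c => by
      by_cases hc : I c ≤ m
      · obtain ⟨t, ht⟩ := Option.ne_none_iff_exists'.1 ((hσ.1 c).2 hc)
        exact ⟨z.symm t, fun _ => by simp [ht]⟩
      · exact ⟨c, fun h0 => absurd h0 hc⟩
    choose g hg using h1
    have h2 := eq_self_of_injOn_of_le (ι := ιᵒᵈ) (fun j => I j.ofDual ≤ m) g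
      (fun j hj => (hord (hle _ _ (hg j hj))).trans hj)
      (fun i j hi hj hij => by
        have := hg i hi
        rw [hij] at this
        exact hσ.2.2 i j _ this (hg j hj))
      (fun j hj => hle _ _ (hg j hj))
    intro c hc
    rw [hg c hc, h2 c hc]

theorem layerWeight_restrictColor_succ {I : ι → ℕ} {z : ι ≃ U}
    (hord : Monotone (κ ∘ z) ∨ Antitone I) {m : ℕ}
    (hm : ∀ i, κ (z i) ≤ m + 1 ↔ I i ≤ m + 1) [Decidable (∀ i, κ (z i) ≤ m ↔ I i ≤ m)] :
    layerWeight h x κ I (m + 1) (restrictColor I z (m + 1)) =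
      if ∀ i, κ (z i) ≤ m ↔ I i ≤ m then
        h ^ Fintype.card {u // κ u ≤ m} * pairProd (pairFactor h x)
          (fun i => (restrictColor I z (m + 1) i, restrictColor I z m i)) *
        layerWeight h x κ I m (restrictColor I z m) else 0 := by
  classical
  rw [layerWeight, Finset.sum_eq_single (restrictColor I z m)]
  · simp only [isLayer_restrictColor_iff]
  · intro σ _ hne
    split_ifs with hσ
    · by_cases h0 : pairProd (pairFactor h x) (fun i => (restrictColor I z (m + 1) i, σ i)) = 0
      · rw [h0]; ring
      · exact absurd (eq_restrictColor_of_pairProd_ne_zero h x κ hord hm hσ h0) hne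
    · rfl
  · exact fun h0 => absurd (Finset.mem_univ _) h0

theorem color_eq_of_layerWeight_ne_zero {I : ι → ℕ} {z : ι ≃ U}
    (hord : Monotone (κ ∘ z) ∨ Antitone I) : ∀ m : ℕ, (∀ i, κ (z i) ≤ m ↔ I i ≤ m) →
    layerWeight h x κ I m (restrictColor I z m) ≠ 0 → ∀ i, I i ≤ m → κ (z i) = I i
  | 0, hm, _, i, hi => by
    have := (hm i).2 hi
    omega
  | m + 1, hm, hne, i, hi => by
    classical
    rw [layerWeight_restrictColor_succ h x κ hord hm] at hne
    split_ifs at hne with hm'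
    · by_cases hi' : I i ≤ m
      · exact color_eq_of_layerWeight_ne_zero hord m hm' (right_ne_zero_of_mul hne) i hi'
      · have h1 := (hm i).2 hi
        have h2 := mt (hm' i).1 hi'
        omega
    · exact absurd rfl hne

theorem layerWeight_restrictColor_eq_prod {z : ι ≃ U} {I : ι → ℕ} (hI : ∀ i, κ (z i) = I i)
    (hord : Monotone I ∨ Antitone I) (m : ℕ) :
    layerWeight h x κ I m (restrictColor I z m) = ∏ p ∈ Finset.range m,
      (h ^ Fintype.card {u // κ u ≤ p} * pairProd (pairFactor h x)
          (fun i => (restrictColor I z (p + 1) i, restrictColor I z p i))) := by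
  classical
  have hI' : κ ∘ z = I := funext hI
  induction m with
  | zero => simp [layerWeight]
  | succ m ih =>
    rw [layerWeight_restrictColor_succ h x κ (by rwa [hI']) (fun i => by rw [hI]),
      if_pos (fun i => by rw [hI]), ih, Finset.prod_range_succ, mul_comm]

theorem layer_prod_eq (z : ι ≃ U) (I : ι → ℕ) (p : ℕ)
    (g : U → U → K) (hd : ∀ u, g u u = if κ u ≤ p then h else 1)
    (hg : ∀ i j, i < j → pairFactor h x (restrictColor I z (p + 1) i, restrictColor I z p i)
      (restrictColor I z (p + 1) j, restrictColor I z p j) = g (z i) (z j) * g (z j) (z i)) :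
    h ^ Fintype.card {u // κ u ≤ p} * pairProd (pairFactor h x)
          (fun i => (restrictColor I z (p + 1) i, restrictColor I z p i)) = ∏ u, ∏ v, g u v := by
  rw [← z.prod_comp]
  simp only [← z.prod_comp (g _)]
  rw [prod_prod_eq_prod_mul_pairProd]
  congr 1
  · rw [z.prod_comp (fun u => g u u)]
    simp [hd, Finset.prod_ite, Fintype.card_subtype]
  · refine Finset.prod_congr rfl fun i _ => Finset.prod_congr rfl fun j _ => ?_
    split_ifs with hij
    · exact hg i j hij
    · rfl

theorem layerWeight_of_monotone (hx : Function.Injective x) {z : ι ≃ U} {I : ι → ℕ}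
    (hI : ∀ i, κ (z i) = I i) (hord : Monotone I) (m : ℕ) :
    layerWeight h x κ I m (restrictColor I z m) = ∏ p ∈ Finset.range m,
      ∏ u, ∏ v, if κ u ≤ p ∧ κ v ≤ p + 1 then x u - x v + h else 1 := by
  rw [layerWeight_restrictColor_eq_prod h x κ hI (Or.inl hord)]
  refine Finset.prod_congr rfl fun p _ => layer_prod_eq h x κ z I p _ (fun u => ?_) ?_
  · by_cases hu : κ u ≤ p
    · simp [hu, hu.trans p.le_succ]
    · simp [hu]
  · intro i j hij
    have h1 := hord hij.le
    have h2 : x (z i) - x (z j) ≠ 0 :=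
      sub_ne_zero.2 fun h0 => hij.ne (z.injective (hx h0))
    simp only [hI, restrictColor]
    by_cases hj : I j ≤ p
    · simp [pairFactor, optMap₂, hj, h1.trans hj, (h1.trans hj).trans p.le_succ, hj.trans p.le_succ]
      field_simp
      ring
    · by_cases hi : I i ≤ p
      · by_cases hj' : I j ≤ p + 1
        · simp [pairFactor, optMap₂, hj, hi, hi.trans p.le_succ, hj']
        · simp [pairFactor, optMap₂, hj, hi, hi.trans p.le_succ, hj']
      · simp [pairFactor, optMap₂, hj, hi]

theorem layerWeight_of_antitone (hx : Function.Injective x) {z : ι ≃ U} {I : ι → ℕ}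
    (hI : ∀ i, κ (z i) = I i) (hord : Antitone I) (m : ℕ) :
    layerWeight h x κ I m (restrictColor I z m) = ∏ p ∈ Finset.range m,
      ∏ u, ∏ v, if κ u ≤ p then
        (if κ v ≤ p then x u - x v + h else if κ v ≤ p + 1 then x u - x v else 1) else 1 := by
  rw [layerWeight_restrictColor_eq_prod h x κ hI (Or.inr hord)]
  refine Finset.prod_congr rfl fun p _ => layer_prod_eq h x κ z I p _ (fun u => ?_) ?_
  · by_cases hu : κ u ≤ p
    · simp [hu]
    · simp [hu]
  · intro i j hij
    have h1 := hord hij.le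
    have h2 : x (z i) - x (z j) ≠ 0 :=
      sub_ne_zero.2 fun h0 => hij.ne (z.injective (hx h0))
    simp only [hI, restrictColor]
    by_cases hi : I i ≤ p
    · simp [pairFactor, optMap₂, hi, h1.trans hi, (h1.trans hi).trans p.le_succ, hi.trans p.le_succ]
      field_simp
      ring
    · by_cases hj : I j ≤ p
      · by_cases hi' : I i ≤ p + 1
        · simp [pairFactor, optMap₂, hj, hi, hj.trans p.le_succ, hi']
        · simp [pairFactor, optMap₂, hj, hi, hj.trans p.le_succ, hi']
      · simp [pairFactor, optMap₂, hj, hi]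

end delta
theorem Fin.perm_induction_covBy {L : ℕ} {motive : Equiv.Perm (Fin L) → Prop} (one : motive 1)
    (mul_swap : ∀ (π : Equiv.Perm (Fin L)) (a b : Fin L), a ⋖ b → motive π →
      motive (π * Equiv.swap a b)) (π : Equiv.Perm (Fin L)) : motive π := by
  rcases L with _ | n
  · rwa [Subsingleton.elim π 1]
  · refine Submonoid.induction_of_closure_eq_top_right
      (Equiv.Perm.mclosure_swap_castSucc_succ n) π one ?_
    rintro π _ ⟨i, rfl⟩ hπ
    exact mul_swap _ _ _ (Fin.covBy_iff.2 (by simp)) hπ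

theorem Fin.exists_covBy_of_not_monotone {L : ℕ} {α : Type*} [LinearOrder α] {f : Fin L → α}
    (hf : ¬ Monotone f) : ∃ a b, a ⋖ b ∧ f b < f a := by
  rcases L with _ | n
  · exact absurd (fun i => i.elim0) hf
  · rw [Fin.monotone_iff_le_succ] at hf
    push Not at hf
    obtain ⟨i, hi⟩ := hf
    exact ⟨_, _, Fin.covBy_iff.2 (by simp), hi⟩

/-- Families indexed by words `I` and variables `z` that satisfy the exchange relation of a row of
the Yangian for each pair of adjacent positions. -/
def IsExchangeFamily {K V U : Type*} [Field K] [AddCommGroup V] [Module K V] {L : ℕ} (h : K)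
    (x : U → K) (B : (Fin L → ℕ) → (Fin L → U) → V) : Prop :=
  ∀ I z a b, a ⋖ b → (x (z a) - x (z b) + h) • B I z =
    (x (z a) - x (z b)) • B (I ∘ Equiv.swap a b) (z ∘ Equiv.swap a b) +
      h • B I (z ∘ Equiv.swap a b)

namespace IsExchangeFamily

variable {K V U : Type*} [Field K] [AddCommGroup V] [Module K V] {L : ℕ} {h : K} {x : U → K}
  {B : (Fin L → ℕ) → (Fin L → U) → V}

theorem comp_left (hB : IsExchangeFamily h x B) (φ : ℕ → ℕ) :
    IsExchangeFamily h x fun I z => B (φ ∘ I) z :=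
  fun I z a b hab => hB (φ ∘ I) z a b hab

theorem sub_sum {𝒴 : Type*} [Fintype 𝒴] (hB : IsExchangeFamily h x B)
    {C : 𝒴 → (Fin L → ℕ) → (Fin L → U) → V} (hC : ∀ Y, IsExchangeFamily h x (C Y)) (c : 𝒴 → K) :
    IsExchangeFamily h x fun I z => B I z - ∑ Y, c Y • C Y I z := by
  intro I z a b hab
  simp only [smul_sub, Finset.smul_sum, smul_comm _ (c _), hB I z a b hab, hC _ I z a b hab,
    smul_add, Finset.sum_add_distrib]
  abel

theorem eq_zero_of_forall_eq_zero (hB : IsExchangeFamily h x B) (hx : Function.Injective x)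
    {I : Fin L → ℕ} (hI : ∀ z, Function.Injective z → B I z = 0) (π : Equiv.Perm (Fin L)) :
    ∀ z, Function.Injective z → B (I ∘ π) z = 0 := by
  induction π using Fin.perm_induction_covBy with
  | one => exact hI
  | mul_swap π a b hab ih =>
    intro z hz
    have hz' : Function.Injective (z ∘ Equiv.swap a b) := hz.comp (Equiv.injective _)
    have key := hB (I ∘ π) (z ∘ Equiv.swap a b) a b hab
    have hzz : (z ∘ Equiv.swap a b) ∘ Equiv.swap a b = z := by ext; simp
    rw [hzz, ih z hz, ih _ hz', smul_zero, smul_zero, add_zero, eq_comm,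
      smul_eq_zero_iff_right] at key
    · exact key
    · exact sub_ne_zero.2 fun h0 => hab.1.ne (hz' (hx h0))

theorem apply_comp_perm (hB : IsExchangeFamily h x B) (hgen : ∀ u v, x u - x v + h ≠ 0)
    {I : Fin L → ℕ} (hI : Monotone I) (z : Fin L → U) (w : Equiv.Perm (Fin L))
    (hw : I ∘ w = I) : B I (z ∘ w) = B I z := by
  generalize hn : ∑ i : Fin L, (L - i.1) * (w i).1 = n
  induction n using Nat.strong_induction_on generalizing w with
  | _ n ih =>
    by_cases hmono : Monotone w
    · have : w = 1 := by
        have h1 : StrictMono w := hmono.strictMono_of_injective w.injective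
        have := Subsingleton.elim (h1.orderIsoOfSurjective _ w.surjective) (OrderIso.refl _)
        ext i
        have := congrArg (fun e : Fin L ≃o Fin L => (e i).1) this
        simpa using this
      rw [this]
      rfl
    · obtain ⟨a, b, hab, hlt⟩ := Fin.exists_covBy_of_not_monotone hmono
      have h1 : I a ≤ I b := hI hab.1.le
      have h2 : I (w b) ≤ I (w a) := hI hlt.le
      have h3 : I a = I b := by
        have h4 := congrFun hw a
        have h5 := congrFun hw b
        simp only [Function.comp_apply] at h4 h5
        omega
      have hIs : I ∘ Equiv.swap a b = I := by
        ext i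
        simp only [Function.comp_apply, Equiv.swap_apply_def]
        split_ifs with h4 h5
        · rw [h4, h3]
        · rw [h5, h3]
        · rfl
      have key := hB I (z ∘ w) a b hab
      rw [hIs, ← add_smul] at key
      rw [smul_right_injective V (hgen _ _) key]
      refine ih _ ?_ (w * Equiv.swap a b) ?_ rfl
      · rw [← hn, sum_eq_add_add_sum_compl _ hab.1.ne, sum_eq_add_add_sum_compl _ hab.1.ne]
        refine add_lt_add_of_lt_of_le ?_ (Finset.sum_le_sum fun i hi => ?_)
        · have h5 : a.1 < b.1 := hab.1
          have h6 : (w b).1 < (w a).1 := hlt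
          have h7 := b.2
          simp only [Equiv.Perm.coe_mul, Function.comp_apply, Equiv.swap_apply_left,
            Equiv.swap_apply_right]
          obtain ⟨c, hc⟩ : ∃ c, L - a.1 = L - b.1 + c := ⟨b.1 - a.1, by omega⟩
          rw [hc]
          have h8 : c * (w b).1 < c * (w a).1 := Nat.mul_lt_mul_of_pos_left h6 (by omega)
          linarith [add_mul (L - b.1) c (w b).1, add_mul (L - b.1) c (w a).1]
        · simp only [Finset.mem_compl, Finset.mem_insert, Finset.mem_singleton, not_or] at hi
          simp [Equiv.swap_apply_of_ne_of_ne hi.1 hi.2]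
      · rw [Equiv.Perm.coe_mul, ← Function.comp_assoc, hw, hIs]

theorem sum_smul_comp_perm {W : (Fin L → ℕ) → (Fin L → U) → K} (hB : IsExchangeFamily h x B)
    (hW : IsExchangeFamily (-h) x W) (hgen : ∀ u v, x u - x v + h ≠ 0)
    {S : Finset (Fin L → ℕ)} (hS : ∀ I ∈ S, ∀ a b, I ∘ Equiv.swap a b ∈ S) (z : Fin L → U)
    (π : Equiv.Perm (Fin L)) :
    ∑ I ∈ S, W I z • B I z = ∑ I ∈ S, W I (z ∘ π) • B I (z ∘ π) := by
  induction π using Fin.perm_induction_covBy with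
  | one => rfl
  | mul_swap π a b hab ih =>
    rw [ih, Equiv.Perm.coe_mul, ← Function.comp_assoc]
    generalize z ∘ π = z
    have hss : ∀ I : Fin L → ℕ, (I ∘ Equiv.swap a b) ∘ Equiv.swap a b = I := fun I => by ext; simp
    have reindex : ∀ G : (Fin L → ℕ) → V, ∑ I ∈ S, G (I ∘ Equiv.swap a b) = ∑ I ∈ S, G I :=
      fun G => Finset.sum_nbij' (fun I => I ∘ Equiv.swap a b) (fun I => I ∘ Equiv.swap a b)
        (fun I hI => hS I hI a b) (fun I hI => hS I hI a b) (fun I _ => hss I) (fun I _ => hss I)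
        (fun I _ => rfl)
    have hne : (x (z a) - x (z b) - h) * (x (z a) - x (z b) + h) ≠ 0 := by
      refine mul_ne_zero ?_ (hgen _ _)
      exact fun h0 => hgen (z b) (z a) (by linear_combination -h0)
    apply smul_right_injective V hne
    set d := x (z a) - x (z b)
    set z' := z ∘ Equiv.swap a b
    have key : ∀ I, ((d - h) * (d + h)) • W I z • B I z =
        (d * d) • (W (I ∘ Equiv.swap a b) z' • B (I ∘ Equiv.swap a b) z') -
          (h * h) • (W I z' • B I z') + ((d * h) • (W (I ∘ Equiv.swap a b) z' • B I z') -
          (d * h) • (W I z' • B (I ∘ Equiv.swap a b) z')) := fun I => by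
      have h1 := hW I z a b hab
      have h2 := hB I z a b hab
      rw [smul_eq_mul, smul_eq_mul, smul_eq_mul, ← sub_eq_add_neg] at h1
      calc ((d - h) * (d + h)) • W I z • B I z = ((d - h) * W I z) • (d + h) • B I z := by
            simp only [smul_smul]; congr 1; ring
        _ = _ := by
          rw [h1, h2]
          module
    simp only [Finset.smul_sum]
    rw [Finset.sum_congr rfl fun I _ => key I, Finset.sum_add_distrib, Finset.sum_sub_distrib,
      Finset.sum_sub_distrib, reindex fun I => (d * d) • (W I z' • B I z')]
    have h3 := reindex fun I => (d * h) • (W I z' • B (I ∘ Equiv.swap a b) z')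
    simp only [hss] at h3
    rw [h3, sub_self, add_zero, ← Finset.sum_sub_distrib]
    refine Finset.sum_congr rfl fun I _ => ?_
    module

end IsExchangeFamily

theorem isExchangeFamily_layerWeight {K U : Type*} [Field K] [Fintype U] {L : ℕ} (h : K) {x : U → K}
    (hx : Function.Injective x) (κ : U → ℕ) (m : ℕ) :
    IsExchangeFamily (-h) x fun (I : Fin L → ℕ) z => layerWeight h x κ I m (some ∘ z) := by
  intro I z a b hab
  have := layerWeight_exchange h x κ hx hab I m (some ∘ z) (z a) (z b) rfl rfl
  simp only [smul_eq_mul, neg_mul, ← sub_eq_add_neg]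
  exact this
theorem restrictColor_eq_some_comp {ι U : Type*} {I : ι → ℕ} {m : ℕ} (hI : ∀ i, I i ≤ m) (z : ι → U) :
    restrictColor I z m = some ∘ z :=
  funext fun i => if_pos (hI i)

section expansion

variable {K U : Type*} [Field K] [Fintype U] {h : K} {x : U → K} {M : ℕ} {κ : U → ℕ}

theorem prod_range_antitone_ne_zero (hgen : ∀ u v, x u - x v + h ≠ 0)
    (hx : Function.Injective x) (m : ℕ) :
    (∏ p ∈ Finset.range m, ∏ u, ∏ v, if κ u ≤ p then
        (if κ v ≤ p then x u - x v + h else if κ v ≤ p + 1 then x u - x v else 1) else 1) ≠ 0 := by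
  refine Finset.prod_ne_zero_iff.2 fun p _ => Finset.prod_ne_zero_iff.2 fun u _ =>
    Finset.prod_ne_zero_iff.2 fun v _ => ?_
  split_ifs with h1 h2
  · exact hgen u v
  · exact sub_ne_zero.2 fun h0 => h2 (hx h0 ▸ h1)
  · exact one_ne_zero
  · exact one_ne_zero

theorem prod_range_monotone_div_antitone (hgen : ∀ u v, x u - x v + h ≠ 0) (hκ : ∀ u, κ u ≤ M) :
    (∏ p ∈ Finset.range M, ∏ u, ∏ v, if κ u ≤ p ∧ κ v ≤ p + 1 then x u - x v + h else 1) /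
      (∏ p ∈ Finset.range M, ∏ u, ∏ v, if κ u ≤ p then
        (if κ v ≤ p then x u - x v + h else if κ v ≤ p + 1 then x u - x v else 1) else 1) =
    ∏ u, ∏ v, if κ u < κ v then (x u - x v + h) / (x u - x v) else 1 := by
  simp only [← Finset.prod_div_distrib]
  rw [Finset.prod_comm]
  refine Finset.prod_congr rfl fun u _ => ?_
  rw [Finset.prod_comm]
  refine Finset.prod_congr rfl fun v _ => ?_
  have key : ∀ p ∈ Finset.range M, p ≠ κ v - 1 →
      (if κ u ≤ p ∧ κ v ≤ p + 1 then x u - x v + h else 1) / (if κ u ≤ p then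
        (if κ v ≤ p then x u - x v + h else if κ v ≤ p + 1 then x u - x v else 1) else 1) = 1 := by
    intro p _ hp
    by_cases h1 : κ u ≤ p
    · by_cases h2 : κ v ≤ p
      · simp [h1, h2, h2.trans p.le_succ, hgen u v]
      · simp [h1, h2, show ¬ κ v ≤ p + 1 by omega]
    · simp [h1]
  split_ifs with h1
  · have h2 := hκ v
    rw [Finset.prod_eq_single (κ v - 1) key
      (fun h0 => absurd (Finset.mem_range.2 (show κ v - 1 < M by omega)) h0)]
    simp [show κ u ≤ κ v - 1 by omega, show κ v ≤ κ v - 1 + 1 by omega,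
      show ¬ κ v ≤ κ v - 1 by omega]
  · refine Finset.prod_eq_one fun p hp => ?_
    by_cases h2 : p = κ v - 1
    · by_cases h3 : κ u ≤ p
      · have h4 : κ v ≤ p := by omega
        simp [h3, h4, h4.trans p.le_succ, hgen u v]
      · simp [h3]
    · exact key p hp h2

theorem exchange_expansion {V : Type*} [AddCommGroup V] [Module K V] {L : ℕ}
    (hx : Function.Injective x) (hgen : ∀ u v, x u - x v + h ≠ 0)
    {A : (Fin L → ℕ) → (Fin L → U) → V} (hA : IsExchangeFamily h x A)
    {I : Fin L → ℕ} (hI : Monotone I) (hIM : ∀ i, I i ≤ M)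
    {𝒴 : Type*} [Fintype 𝒴] {κ : 𝒴 → U → ℕ} (hκ : Function.Injective κ)
    {z z' : 𝒴 → Fin L ≃ U} (hz : ∀ Y i, κ Y (z Y i) = I i) (hz' : ∀ Y, Antitone (κ Y ∘ z' Y))
    (hsurj : ∀ w : Fin L ≃ U, ∃ Y, ∀ i, κ Y (w i) = I i)
    {κ₀ : U → ℕ} {z₀ : Fin L ≃ U} (hz₀ : ∀ i, κ₀ (z₀ i) = I i) :
    (∏ p ∈ Finset.range M, ∏ u, ∏ v, if κ₀ u ≤ p ∧ κ₀ v ≤ p + 1 then x u - x v + h else 1) •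
        A I z₀ =
      ∑ Y, (layerWeight h x κ₀ I M (some ∘ z Y) *
        ∏ u, ∏ v, if κ Y v < κ Y u then (x u - x v + h) / (x u - x v) else 1) •
          A (κ Y ∘ z' Y) (z' Y) := by
  classical
  have hgen' : ∀ u v, x u - x v + -h ≠ 0 := fun u v h0 => hgen v u (by linear_combination -h0)
  have hκM : ∀ Y u, κ Y u ≤ M := fun Y u => by
    rw [← (z Y).apply_symm_apply u, hz]
    exact hIM _
  set φ : ℕ → ℕ := fun c => M - c with hφ
  have hφφ : ∀ c, c ≤ M → φ (φ c) = c := fun c hc => by simp only [hφ]; omega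
  have hφM : ∀ c, φ c ≤ M := fun c => Nat.sub_le _ _
  have hφa : Antitone φ := fun a b hab => Nat.sub_le_sub_left hab M
  -- the weight functions for the opposite order of the colours
  let W : 𝒴 → (Fin L → ℕ) → (Fin L → U) → K := fun Y J w =>
    layerWeight h x (φ ∘ κ Y) (φ ∘ J) M (some ∘ w)
  have hW : ∀ Y, IsExchangeFamily (-h) x (W Y) := fun Y =>
    (isExchangeFamily_layerWeight h hx (φ ∘ κ Y) M).comp_left φ
  let Q : 𝒴 → K := fun Y => ∏ p ∈ Finset.range M, ∏ u, ∏ v, if (φ ∘ κ Y) u ≤ p then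
        (if (φ ∘ κ Y) v ≤ p then x u - x v + h else if (φ ∘ κ Y) v ≤ p + 1 then x u - x v else 1)
        else 1
  let P : 𝒴 → K := fun Y => ∏ p ∈ Finset.range M, ∏ u, ∏ v,
    if (φ ∘ κ Y) u ≤ p ∧ (φ ∘ κ Y) v ≤ p + 1 then x u - x v + h else 1
  have hQ : ∀ Y, Q Y ≠ 0 := fun Y => prod_range_antitone_ne_zero hgen hx M
  -- the expansion of scalar families
  have hB := isExchangeFamily_layerWeight (L := L) h hx κ₀ M
  have expand : ∀ (π : Equiv.Perm (Fin L)) (w : Fin L → U), Function.Injective w →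
      layerWeight h x κ₀ (I ∘ π) M (some ∘ w) =
        ∑ Y, (layerWeight h x κ₀ I M (some ∘ z Y) / Q Y) • W Y (I ∘ π) w := by
    intro π w hw
    rw [← sub_eq_zero]
    refine (hB.sub_sum hW _).eq_zero_of_forall_eq_zero hx (I := I) (fun w hw => ?_) π w hw
    have hbij : Function.Bijective w :=
      (Fintype.bijective_iff_injective_and_card w).2 ⟨hw, Fintype.card_congr z₀⟩
    obtain ⟨w, rfl⟩ : ∃ e : Fin L ≃ U, w = e := ⟨Equiv.ofBijective w hbij, rfl⟩
    obtain ⟨Y, hY⟩ := hsurj w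
    have hanti : Antitone (φ ∘ I) := hφa.comp_monotone hI
    rw [sub_eq_zero, Finset.sum_eq_single Y]
    · have h1 : W Y I w = Q Y := by
        simp only [W]
        rw [← restrictColor_eq_some_comp (I := φ ∘ I) (fun i => hφM _)]
        exact layerWeight_of_antitone h x (φ ∘ κ Y) hx
          (fun i => congrArg φ (hY i)) hanti M
      rw [h1, smul_eq_mul, div_mul_cancel₀ _ (hQ Y)]
      have h2 := hB.apply_comp_perm hgen' hI w ((z Y).trans w.symm) (by
        ext i
        simp [← hY, hz])
      rw [← h2]
      congr 1
      ext i
      simp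
    · intro Y' _ hne
      rw [smul_eq_mul, mul_eq_zero]
      refine Or.inr (by_contra fun h0 => hne (hκ ?_))
      simp only [W] at h0
      rw [← restrictColor_eq_some_comp (I := φ ∘ I) (fun i => hφM _)] at h0
      have h1 := color_eq_of_layerWeight_ne_zero h x (φ ∘ κ Y') (Or.inr hanti) M
        (fun i => by simp [hφM]) h0
      ext u
      have h2 := congrArg φ (h1 (w.symm u) (hφM _))
      simp only [Function.comp_apply, Equiv.apply_symm_apply] at h2
      rw [hφφ _ (hκM _ _), hφφ _ (hIM _)] at h2
      rw [h2, ← hY, Equiv.apply_symm_apply]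
    · exact fun h0 => absurd (Finset.mem_univ _) h0
  -- sums over all words are independent of the order of the variables
  let S : Finset (Fin L → ℕ) := Finset.univ.image fun π : Equiv.Perm (Fin L) => I ∘ π
  have hS : ∀ J ∈ S, ∀ a b, J ∘ Equiv.swap a b ∈ S := by
    intro J hJ a b
    obtain ⟨π, -, rfl⟩ := Finset.mem_image.1 hJ
    exact Finset.mem_image.2 ⟨π * Equiv.swap a b, Finset.mem_univ _, rfl⟩
  have hleft : ∑ J ∈ S, layerWeight h x κ₀ J M (some ∘ z₀) • A J z₀ =
      (∏ p ∈ Finset.range M, ∏ u, ∏ v, if κ₀ u ≤ p ∧ κ₀ v ≤ p + 1 then x u - x v + h else 1) •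
        A I z₀ := by
    have hmono : Monotone (κ₀ ∘ z₀) := by rwa [show κ₀ ∘ z₀ = I from funext hz₀]
    rw [Finset.sum_eq_single I]
    · rw [← restrictColor_eq_some_comp hIM, layerWeight_of_monotone h x κ₀ hx hz₀ hI]
    · intro J hJ hne
      obtain ⟨π, -, rfl⟩ := Finset.mem_image.1 hJ
      rw [smul_eq_zero]
      refine Or.inl (by_contra fun h0 => hne ?_)
      rw [← restrictColor_eq_some_comp (I := I ∘ π) (fun i => hIM _)] at h0
      have h1 := color_eq_of_layerWeight_ne_zero h x κ₀ (Or.inl hmono) M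
        (fun i => by simp [hIM, hz₀]) h0
      ext i
      rw [← h1 i (hIM _), hz₀]
    · exact fun h0 => absurd (Finset.mem_image.2 ⟨1, Finset.mem_univ _, rfl⟩) h0
  have hright : ∀ Y, ∑ J ∈ S, W Y J z₀ • A J z₀ = P Y • A (κ Y ∘ z' Y) (z' Y) := by
    intro Y
    have h1 := hA.sum_smul_comp_perm (hW Y) hgen hS z₀ ((z' Y).trans z₀.symm)
    have h2 : z₀ ∘ ((z' Y).trans z₀.symm) = z' Y := by ext i; simp
    rw [h1, h2]
    have hmono : Monotone (φ ∘ κ Y ∘ z' Y) := hφa.comp (hz' Y)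
    rw [Finset.sum_eq_single (κ Y ∘ z' Y)]
    · congr 1
      simp only [W]
      rw [← restrictColor_eq_some_comp (I := φ ∘ κ Y ∘ z' Y) (fun i => hφM _)]
      exact layerWeight_of_monotone h x (φ ∘ κ Y) hx (fun _ => rfl) hmono M
    · intro J hJ hne
      obtain ⟨π, -, rfl⟩ := Finset.mem_image.1 hJ
      rw [smul_eq_zero]
      refine Or.inl (by_contra fun h0 => hne ?_)
      simp only [W] at h0
      rw [← restrictColor_eq_some_comp (I := φ ∘ I ∘ π) (fun i => hφM _)] at h0
      have h1 := color_eq_of_layerWeight_ne_zero h x (φ ∘ κ Y) (Or.inl hmono) M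
        (fun i => by simp [hφM]) h0
      ext i
      have h2 := congrArg φ (h1 i (hφM _))
      simp only [Function.comp_apply] at h2
      rw [hφφ _ (hκM _ _), hφφ _ (hIM _)] at h2
      exact h2.symm
    · refine fun h0 => absurd (Finset.mem_image.2 ⟨(z' Y).trans (z Y).symm, Finset.mem_univ _, ?_⟩) h0
      ext i
      simp [← hz Y]
  rw [← hleft]
  have hsum : ∀ J ∈ S, layerWeight h x κ₀ J M (some ∘ z₀) • A J z₀ =
      ∑ Y, (layerWeight h x κ₀ I M (some ∘ z Y) / Q Y) • W Y J z₀ • A J z₀ := by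
    intro J hJ
    obtain ⟨π, -, rfl⟩ := Finset.mem_image.1 hJ
    rw [expand π z₀ z₀.injective, Finset.sum_smul]
    simp only [smul_assoc]
  rw [Finset.sum_congr rfl hsum, Finset.sum_comm]
  refine Finset.sum_congr rfl fun Y _ => ?_
  rw [← Finset.smul_sum, hright, smul_smul]
  congr 1
  rw [div_mul_eq_mul_div, mul_div_assoc]
  congr 1
  refine (prod_range_monotone_div_antitone hgen fun u => hφM _).trans ?_
  refine Finset.prod_congr rfl fun u _ => Finset.prod_congr rfl fun v _ => ?_
  have : (φ ∘ κ Y) u < (φ ∘ κ Y) v ↔ κ Y v < κ Y u := by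
    have h1 := hκM Y u
    have h2 := hκM Y v
    simp only [hφ, Function.comp_apply]
    omega
  exact if_congr this rfl rfl

end expansion
/-- The series `∑ F r s t_a ^ r t_b ^ s` in two of the variables. -/
noncomputable def seriesIn₂ {σ A : Type*} [Semiring A] (a b : σ) (F : ℕ → ℕ → A) : MvPowerSeries σ A :=
  open Classical in fun d =>
    if d = Finsupp.single a (d a) + Finsupp.single b (d b) then F (d a) (d b) else 0

section series

variable {σ A : Type*} [Ring A] {a b : σ}

theorem seriesIn₂_injective (hab : a ≠ b) :
    Function.Injective (seriesIn₂ a b : (ℕ → ℕ → A) → MvPowerSeries σ A) := by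
  intro F G h
  ext r s
  simpa [seriesIn₂, hab, hab.symm] using congrFun h (Finsupp.single a r + Finsupp.single b s)

theorem seriesIn₂_swap (F : ℕ → ℕ → A) : seriesIn₂ b a (fun r s => F s r) = seriesIn₂ a b F := by
  funext d
  simp only [seriesIn₂]
  congr 1
  rw [add_comm]

theorem seriesIn_mul_seriesIn (hab : a ≠ b) (f g : ℕ → A) :
    seriesIn a f * seriesIn b g = seriesIn₂ a b fun r s => f r * g s := by
  classical
  ext d
  have h1 : ∀ p ∈ Finset.HasAntidiagonal.antidiagonal d,
      ¬ (d = Finsupp.single a (d a) + Finsupp.single b (d b) ∧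
        p = (Finsupp.single a (d a), Finsupp.single b (d b))) →
      MvPowerSeries.coeff p.1 (seriesIn a f) * MvPowerSeries.coeff p.2 (seriesIn b g) = 0 := by
    rintro ⟨p, q⟩ hp hne
    rw [Finset.HasAntidiagonal.mem_antidiagonal] at hp
    rw [MvPowerSeries.coeff_apply, MvPowerSeries.coeff_apply, seriesIn, seriesIn]
    by_cases hp' : p = Finsupp.single a (p a)
    · by_cases hq' : q = Finsupp.single b (q b)
      · have ha : d a = p a := by
          rw [← hp]
          simp only [Finsupp.add_apply]
          rw [hq']
          simp [hab.symm]
        have hb : d b = q b := by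
          rw [← hp]
          simp only [Finsupp.add_apply]
          rw [hp']
          simp [hab]
        refine absurd ?_ hne
        rw [ha, hb, ← hp', ← hq']
        exact ⟨hp.symm, rfl⟩
      · simp only
        rw [if_neg hq', mul_zero]
    · simp only
      rw [if_neg hp', zero_mul]
  rw [MvPowerSeries.coeff_mul, MvPowerSeries.coeff_apply (seriesIn₂ _ _ _), seriesIn₂]
  split_ifs with hd
  · rw [Finset.sum_eq_single (Finsupp.single a (d a), Finsupp.single b (d b))]
    · simp [MvPowerSeries.coeff_apply, seriesIn]
    · exact fun p hp hne => h1 p hp fun h0 => hne h0.2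
    · exact fun h0 => absurd (Finset.HasAntidiagonal.mem_antidiagonal.2 hd.symm) h0
  · exact Finset.sum_eq_zero fun p hp => h1 p hp fun h0 => hd h0.1

theorem X_mul_seriesIn₂ (hab : a ≠ b) (F : ℕ → ℕ → A) :
    MvPowerSeries.X a * seriesIn₂ a b F =
      seriesIn₂ a b fun r s => if r = 0 then 0 else F (r - 1) s := by
  classical
  ext d
  rw [MvPowerSeries.X_def, MvPowerSeries.coeff_monomial_mul, one_mul, MvPowerSeries.coeff_apply,
    MvPowerSeries.coeff_apply, seriesIn₂, seriesIn₂]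
  by_cases hd : d a = 0
  · simp [hd]
  · have h1 : Finsupp.single a 1 ≤ d := by simpa using Nat.one_le_iff_ne_zero.2 hd
    have h2 : (d - Finsupp.single a 1 : σ →₀ ℕ) a = d a - 1 := by simp
    have h3 : (d - Finsupp.single a 1 : σ →₀ ℕ) b = d b := by simp [hab]
    rw [if_pos h1, h2, h3, if_neg hd]
    have h4 : d - Finsupp.single a 1 = Finsupp.single a (d a - 1) + Finsupp.single b (d b) ↔
        d = Finsupp.single a (d a) + Finsupp.single b (d b) := by
      rw [tsub_eq_iff_eq_add_of_le h1, add_right_comm, ← Finsupp.single_add,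
        Nat.sub_add_cancel (Nat.one_le_iff_ne_zero.2 hd)]
    simp only [h4]

theorem X_mul_seriesIn₂' (hab : a ≠ b) (F : ℕ → ℕ → A) :
    MvPowerSeries.X b * seriesIn₂ a b F =
      seriesIn₂ a b fun r s => if s = 0 then 0 else F r (s - 1) := by
  rw [← seriesIn₂_swap, X_mul_seriesIn₂ hab.symm, ← seriesIn₂_swap]

theorem seriesIn₂_add (F G : ℕ → ℕ → A) : seriesIn₂ a b F + seriesIn₂ a b G = seriesIn₂ a b (F + G) := by
  ext d
  rw [map_add]
  simp only [MvPowerSeries.coeff_apply, seriesIn₂]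
  split_ifs <;> simp

theorem seriesIn₂_sub (F G : ℕ → ℕ → A) : seriesIn₂ a b F - seriesIn₂ a b G = seriesIn₂ a b (F - G) := by
  ext d
  rw [map_sub]
  simp only [MvPowerSeries.coeff_apply, seriesIn₂]
  split_ifs <;> simp

theorem C_mul_seriesIn₂ (c : A) (F : ℕ → ℕ → A) :
    MvPowerSeries.C c * seriesIn₂ a b F = seriesIn₂ a b fun r s => c * F r s := by
  ext d
  rw [MvPowerSeries.coeff_C_mul]
  simp only [MvPowerSeries.coeff_apply, seriesIn₂]
  split_ifs <;> simp

/-- The exchange relation between the series with coefficients `f` and `g` does not depend on the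
variables of these series. -/
theorem seriesIn_exchange_congr {τ : Type*} {a' b' : τ} (hab : a ≠ b) (hab' : a' ≠ b') (c : A)
    (f g : ℕ → A)
    (H : (MvPowerSeries.X b - MvPowerSeries.X a + MvPowerSeries.C c *
        (MvPowerSeries.X a * MvPowerSeries.X b)) * (seriesIn a f * seriesIn b g) =
      (MvPowerSeries.X b - MvPowerSeries.X a) * (seriesIn b g * seriesIn a f) +
        MvPowerSeries.C c * (MvPowerSeries.X a * MvPowerSeries.X b) *
          (seriesIn b f * seriesIn a g)) :
    (MvPowerSeries.X b' - MvPowerSeries.X a' + MvPowerSeries.C c *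
        (MvPowerSeries.X a' * MvPowerSeries.X b')) * (seriesIn a' f * seriesIn b' g) =
      (MvPowerSeries.X b' - MvPowerSeries.X a') * (seriesIn b' g * seriesIn a' f) +
        MvPowerSeries.C c * (MvPowerSeries.X a' * MvPowerSeries.X b') *
          (seriesIn b' f * seriesIn a' g) := by
  simp only [add_mul, sub_mul, mul_assoc, seriesIn_mul_seriesIn hab, seriesIn_mul_seriesIn hab.symm,
    ← seriesIn₂_swap (a := b) (b := a), X_mul_seriesIn₂ hab, X_mul_seriesIn₂' hab,
    C_mul_seriesIn₂, seriesIn₂_add, seriesIn₂_sub] at H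
  simp only [add_mul, sub_mul, mul_assoc, seriesIn_mul_seriesIn hab', seriesIn_mul_seriesIn hab'.symm,
    ← seriesIn₂_swap (a := b') (b := a'), X_mul_seriesIn₂ hab', X_mul_seriesIn₂' hab',
    C_mul_seriesIn₂, seriesIn₂_add, seriesIn₂_sub]
  rw [seriesIn₂_injective hab H]

end series

theorem rMatrix_apply (N : ℕ) {S : Type*} [Ring S] (d h : S) (i j k l : Fin N) :
    rMatrix N d h (i, j) (k, l) =
      (if i = k ∧ j = l then d else 0) + (if i = l ∧ j = k then h else 0) := by
  have h1 : ∀ a b c e : Fin N,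
      (Matrix.single a b (1 : S) ⊗ₖ Matrix.single c e (1 : S)) (i, j) (k, l) =
      if a = i ∧ b = k ∧ c = j ∧ e = l then 1 else 0 := fun a b c e => by
    simp only [Matrix.kroneckerMap_apply, Matrix.single_apply, ite_and]
    split_ifs <;> simp
  have h3 : ∀ a b, (a ≠ b ∧ a = i ∧ a = k ∧ b = j ∧ b = l) ↔
      b = j ∧ a = i ∧ i ≠ j ∧ i = k ∧ j = l := by
    grind
  have h4 : ∀ a b, (a ≠ b ∧ a = i ∧ b = k ∧ b = j ∧ a = l) ↔
      b = j ∧ a = i ∧ i ≠ j ∧ i = l ∧ j = k := by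
    grind
  have h5 : ∀ a , (a = i ∧ a = k ∧ a = j ∧ a = l) ↔ a = i ∧ i = j ∧ i = k ∧ j = l := by
    grind
  simp only [rMatrix, Matrix.add_apply, Matrix.smul_apply, Matrix.sum_apply, h1, smul_eq_mul]
  simp only [Finset.sum_filter, ← ite_and, h3, h4, h5]
  have h6 : ∀ (P : Prop) [Decidable P], (∑ a : Fin N, ∑ b : Fin N,
      if b = j ∧ a = i ∧ P then (1 : S) else 0) = if P then 1 else 0 := fun P _ => by
    simp [ite_and]
  have h7 : ∀ (P : Prop) [Decidable P], (∑ a : Fin N, if a = i ∧ P then (1 : S) else 0) =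
      if P then 1 else 0 := fun P _ => by
    simp [ite_and]
  rw [h6, h6, h7]
  by_cases hij : i = j
  · subst hij
    by_cases h8 : i = k ∧ i = l
    · simp [h8.1.symm, h8.2.symm]
    · simp [h8, show ¬ (i = l ∧ i = k) from fun h0 => h8 h0.symm]
  · simp [hij]

/-- The exchange relation in a row of the Yangian. -/
theorem gen_exchange {N : ℕ} (h : ℂ) {σ : Type*} {a b : σ} (hab : a ≠ b) (n i j : Fin N) :
    (MvPowerSeries.X b - MvPowerSeries.X a + MvPowerSeries.C (algebraMap ℂ (Yangian N h) h) *
        (MvPowerSeries.X a * MvPowerSeries.X b)) *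
          (seriesIn a (gen h n i) * seriesIn b (gen h n j)) =
      (MvPowerSeries.X b - MvPowerSeries.X a) * (seriesIn b (gen h n j) * seriesIn a (gen h n i)) +
        MvPowerSeries.C (algebraMap ℂ (Yangian N h) h) * (MvPowerSeries.X a * MvPowerSeries.X b) *
          (seriesIn b (gen h n i) * seriesIn a (gen h n j)) := by
  refine seriesIn_exchange_congr (a := (0 : Fin 2)) (b := 1) (by decide) hab _ _ _ ?_
  have hT : ∀ (c : Fin 2) (k l : Fin N),
      MvPowerSeries.map (RingQuot.mkRingHom (Rel N h)) (freeT N c k l) =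
        seriesIn c (gen h k l) := fun c k l => by
    ext d
    rw [MvPowerSeries.coeff_map, MvPowerSeries.coeff_apply, MvPowerSeries.coeff_apply, freeT,
      Matrix.of_apply, seriesIn, seriesIn]
    split_ifs
    · rw [gen, ← RingQuot.mkAlgHom_coe ℂ]
      rfl
    · exact map_zero _
  have key : MvPowerSeries.map (RingQuot.mkRingHom (Rel N h))
        ((scaledR N h * freeT₁ N * freeT₂ N) (n, n) (i, j)) =
      MvPowerSeries.map (RingQuot.mkRingHom (Rel N h))
        ((freeT₂ N * freeT₁ N * scaledR N h) (n, n) (i, j)) := by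
    ext d
    rw [MvPowerSeries.coeff_map, MvPowerSeries.coeff_map]
    exact RingQuot.mkRingHom_rel (Rel.rtt (n, n) (i, j) d)
  have h12 : ∀ k l k' l' : Fin N, (freeT₁ N * freeT₂ N) (k, l) (k', l') =
      freeT N 0 k k' * freeT N 1 l l' := fun k l k' l' => by
    simp [freeT₁, freeT₂, Matrix.mul_apply, Fintype.sum_prod_type, Matrix.kroneckerMap_apply,
      Matrix.one_apply]
  have h21 : ∀ k l k' l' : Fin N, (freeT₂ N * freeT₁ N) (k, l) (k', l') =
      freeT N 1 l l' * freeT N 0 k k' := fun k l k' l' => by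
    simp [freeT₁, freeT₂, Matrix.mul_apply, Fintype.sum_prod_type, Matrix.kroneckerMap_apply,
      Matrix.one_apply]
  have hc : h • (MvPowerSeries.X 0 * MvPowerSeries.X 1 : MvPowerSeries (Fin 2) (FreeGen N)) =
      MvPowerSeries.C (algebraMap ℂ (FreeGen N) h) * (MvPowerSeries.X 0 * MvPowerSeries.X 1) := by
    ext d
    rw [MvPowerSeries.coeff_C_mul, ← Algebra.smul_def]
    rfl
  have hπ : RingQuot.mkRingHom (Rel N h) (algebraMap ℂ (FreeGen N) h) =
      algebraMap ℂ (Yangian N h) h := by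
    rw [← RingQuot.mkAlgHom_coe ℂ]
    exact AlgHom.commutes _ _
  have hcomm : ∀ φ : MvPowerSeries (Fin 2) (Yangian N h),
      Commute φ (MvPowerSeries.C (algebraMap ℂ (Yangian N h) h)) := fun φ => by
    ext d
    rw [MvPowerSeries.coeff_C_mul, MvPowerSeries.coeff_mul_C, Algebra.commutes]
  rw [mul_assoc, Matrix.mul_apply, Matrix.mul_apply] at key
  simp only [Fintype.sum_prod_type, h12, h21, scaledR, rMatrix_apply, hc] at key
  simp [add_mul, mul_add, ite_and, Finset.sum_add_distrib, hT, hπ] at key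
  rw [add_mul, key, ((MvPowerSeries.commute_X _ 1).sub_right (MvPowerSeries.commute_X _ 0)).eq,
    ((hcomm _).mul_right ((MvPowerSeries.commute_X _ 0).mul_right (MvPowerSeries.commute_X _ 1))).eq]

theorem algebraMap_X_ne_zero {σ : Type} (s : σ) :
    algebraMap (MvPolynomial σ ℂ) (RatFun σ) (MvPolynomial.X s) ≠ 0 :=
  (map_ne_zero_iff _ (IsFractionRing.injective _ _)).2 (MvPolynomial.X_ne_zero s)

theorem spec_injective {σ : Type} : Function.Injective (spec : σ → RatFun σ) := fun _ _ hst =>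
  MvPolynomial.X_injective (IsFractionRing.injective (MvPolynomial σ ℂ) (RatFun σ)
    (inv_injective hst))

theorem spec_sub_spec_add_ne_zero {σ : Type} {h : ℂ} (hh : h ≠ 0) (s t : σ) :
    spec s - spec t + algebraMap ℂ (RatFun σ) h ≠ 0 := by
  intro h0
  have hs := algebraMap_X_ne_zero s
  have ht := algebraMap_X_ne_zero t
  have h1 : algebraMap (MvPolynomial σ ℂ) (RatFun σ) (MvPolynomial.X t - MvPolynomial.X s +
      MvPolynomial.C h * (MvPolynomial.X s * MvPolynomial.X t)) = 0 := by
    have h2 : algebraMap (MvPolynomial σ ℂ) (RatFun σ) (MvPolynomial.C h) =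
      algebraMap ℂ (RatFun σ) h := (IsScalarTower.algebraMap_apply ℂ (MvPolynomial σ ℂ) _ h).symm
    simp only [map_add, map_sub, map_mul, h2]
    unfold spec at h0
    field_simp at h0
    linear_combination h0
  rw [map_eq_zero_iff _ (IsFractionRing.injective _ _)] at h1
  have h2 := congrArg (MvPolynomial.eval fun _ => (1 : ℂ)) h1
  simp at h2
  exact hh h2

section

variable {σ : Type} {N : ℕ} {h : ℂ}

theorem algebraMap_smul_one_tmul (p : MvPolynomial σ ℂ) (f : MvPowerSeries σ (Yangian N h)) :
    algebraMap (MvPolynomial σ ℂ) (RatFun σ) p •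
      ((1 : RatFun σ) ⊗ₜ[MvPolynomial σ ℂ] f : SpecAlg σ N h) =
        1 ⊗ₜ[MvPolynomial σ ℂ] (polyToSeries σ N h p * f) := by
  rw [TensorProduct.smul_tmul', smul_eq_mul, mul_one, Algebra.algebraMap_eq_smul_one,
    TensorProduct.smul_tmul]
  rfl

theorem T_exchange_of_ne {s t : σ} (hst : s ≠ t) (n i j : Fin N) :
    (spec s - spec t + algebraMap ℂ (RatFun σ) h) • (T h n i s * T h n j t) =
      (spec s - spec t) • (T h n j t * T h n i s) +
        algebraMap ℂ (RatFun σ) h • (T h n i t * T h n j s) := by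
  have hs := algebraMap_X_ne_zero s
  have ht := algebraMap_X_ne_zero t
  have hC : algebraMap (MvPolynomial σ ℂ) (RatFun σ) (MvPolynomial.C h) =
      algebraMap ℂ (RatFun σ) h := (IsScalarTower.algebraMap_apply ℂ (MvPolynomial σ ℂ) _ h).symm
  have hpX : ∀ s, polyToSeries σ N h (MvPolynomial.X s) = MvPowerSeries.X s := fun s => by
    simp [polyToSeries]
  have hpC : polyToSeries σ N h (MvPolynomial.C h) =
      MvPowerSeries.C (algebraMap ℂ (Yangian N h) h) := by
    simp [polyToSeries]
  have key := congrArg (fun f => (1 : RatFun σ) ⊗ₜ[MvPolynomial σ ℂ] f)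
    (gen_exchange h hst n i j)
  simp only [← hpX, ← hpC, ← map_mul, ← map_sub, ← map_add, TensorProduct.tmul_add] at key
  rw [← algebraMap_smul_one_tmul, ← algebraMap_smul_one_tmul, ← algebraMap_smul_one_tmul] at key
  have key' := congrArg (fun f => (algebraMap (MvPolynomial σ ℂ) (RatFun σ)
    (MvPolynomial.X s * MvPolynomial.X t))⁻¹ • f) key
  simp only [smul_add, smul_smul] at key'
  have hmul : ∀ f g : MvPowerSeries σ (Yangian N h),
      ((1 : RatFun σ) ⊗ₜ[MvPolynomial σ ℂ] f : SpecAlg σ N h) * (1 ⊗ₜ g) = 1 ⊗ₜ (f * g) :=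
    fun f g => by rw [Algebra.TensorProduct.tmul_mul_tmul, one_mul]
  unfold T
  rw [hmul, hmul, hmul]
  convert key' using 3
  · simp only [map_add, map_sub, map_mul, hC, spec]
    field_simp
  · simp only [map_sub, map_mul, spec]
    field_simp
  · simp only [map_mul, hC]
    field_simp

theorem T_exchange (s t : σ) (n i j : Fin N) :
    (spec s - spec t + algebraMap ℂ (RatFun σ) h) • (T h n i s * T h n j t) =
      (spec s - spec t) • (T h n j t * T h n i s) +
        algebraMap ℂ (RatFun σ) h • (T h n i t * T h n j s) := by
  rcases eq_or_ne s t with rfl | hst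
  · simp
  · exact T_exchange_of_ne hst n i j

end

theorem List.exists_finRange_eq_append {n : ℕ} {a b : Fin n} (hab : a ⋖ b) :
    ∃ l₁ l₂, List.finRange n = l₁ ++ a :: b :: l₂ := by
  induction n with
  | zero => exact a.elim0
  | succ n ih =>
    have h1 : a.1 + 1 = b.1 := by simpa [Order.covBy_iff_add_one_eq] using Fin.covBy_iff.1 hab
    rw [List.finRange_succ]
    rcases n with _ | n
    · have := b.2; have := a.2
      omega
    · induction a using Fin.cases with
      | zero =>
        refine ⟨[], (List.finRange n).map (Fin.succ ∘ Fin.succ), ?_⟩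
        have : b = 1 := by ext; simp [← h1]
        simp [List.finRange_succ, this]
      | succ a =>
        obtain ⟨b, rfl⟩ : ∃ c : Fin (n + 1), b = c.succ := ⟨b.pred (by rintro rfl; simp at h1), by simp⟩
        obtain ⟨l₁, l₂, hl⟩ := ih (a := a) (b := b) (by
          rw [Fin.covBy_iff, Order.covBy_iff_add_one_eq]
          simpa using h1)
        exact ⟨0 :: l₁.map Fin.succ, l₂.map Fin.succ, by simp [hl]⟩

/-- Words in operators that satisfy the exchange relation form an exchange family. -/
theorem isExchangeFamily_prod {K R U : Type*} [Field K] [Ring R] [Algebra K R] {L : ℕ} {h : K}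
    {x : U → K} {A : ℕ → U → R}
    (hA : ∀ i j u v, (x u - x v + h) • (A i u * A j v) =
      (x u - x v) • (A j v * A i u) + h • (A i v * A j u)) :
    IsExchangeFamily h x fun (I : Fin L → ℕ) z => (List.ofFn fun k => A (I k) (z k)).prod := by
  intro I z a b hab
  obtain ⟨l₁, l₂, hl⟩ := List.exists_finRange_eq_append hab
  have hnd := List.nodup_finRange L
  rw [hl, List.nodup_append] at hnd
  have h1 : ∀ c ∈ l₁, Equiv.swap a b c = c := fun c hc =>
    Equiv.swap_apply_of_ne_of_ne (hnd.2.2 c hc a (by simp)) (hnd.2.2 c hc b (by simp))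
  have h2 : ∀ c ∈ l₂, Equiv.swap a b c = c := fun c hc => by
    have := hnd.2.1
    simp only [List.nodup_cons, List.mem_cons, not_or] at this
    exact Equiv.swap_apply_of_ne_of_ne (fun h0 => this.1.2 (h0 ▸ hc))
      (fun h0 => this.2.1 (h0 ▸ hc))
  have key : ∀ (J : Fin L → ℕ) (w : Fin L → U), (List.ofFn fun k => A (J k) (w k)).prod =
      (l₁.map fun k => A (J k) (w k)).prod * (A (J a) (w a) * A (J b) (w b)) *
        (l₂.map fun k => A (J k) (w k)).prod := fun J w => by
    rw [List.ofFn_eq_map, hl]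
    simp [mul_assoc]
  have h3 : ∀ (J : Fin L → ℕ) (w : Fin L → U), (∀ c, Equiv.swap a b c = c → J c = I c) →
      (∀ c, Equiv.swap a b c = c → w c = z c) → (List.ofFn fun k => A (J k) (w k)).prod =
      (l₁.map fun k => A (I k) (z k)).prod * (A (J a) (w a) * A (J b) (w b)) *
        (l₂.map fun k => A (I k) (z k)).prod := fun J w hJ hw => by
    rw [key, List.map_congr_left fun c hc => by rw [hJ c (h1 c hc), hw c (h1 c hc)],
      List.map_congr_left (l := l₂) fun c hc => by rw [hJ c (h2 c hc), hw c (h2 c hc)]]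
  simp only
  rw [h3 I z (fun _ _ => rfl) (fun _ _ => rfl),
    h3 (I ∘ Equiv.swap a b) (z ∘ Equiv.swap a b) (fun c hc => congrArg I hc)
      (fun c hc => congrArg z hc),
    h3 I (z ∘ Equiv.swap a b) (fun _ _ => rfl) (fun c hc => congrArg z hc)]
  simp only [Function.comp_apply, Equiv.swap_apply_left, Equiv.swap_apply_right]
  rw [← smul_mul_assoc, ← mul_smul_comm, hA]
  simp only [mul_add, add_mul, mul_smul_comm, smul_mul_assoc]

theorem List.prod_ofFn_orderIso_sigma {m L : ℕ} {n : Fin m → ℕ} {R : Type*} [Monoid R]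
    (e : (Σₗ j, Fin (n j)) ≃o Fin L) (f : (Σₗ j, Fin (n j)) → R) :
    (List.ofFn fun i => f (e.symm i)).prod =
      (List.ofFn fun j => (List.ofFn fun a => f (toLex ⟨j, a⟩)).prod).prod := by
  have key : (List.finRange L).map e.symm =
      ((List.finRange m).map fun j => (List.finRange (n j)).map fun a =>
        (toLex ⟨j, a⟩ : Σₗ j, Fin (n j))).flatten := by
    have hnd : ((List.finRange L).map e.symm).Nodup :=
      (List.nodup_finRange L).map e.symm.injective
    have hpw : ((List.finRange m).map fun j => (List.finRange (n j)).map fun a =>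
        (toLex ⟨j, a⟩ : Σₗ j, Fin (n j))).flatten.Pairwise (· < ·) := by
      rw [List.pairwise_flatten]
      constructor
      · intro l hl
        obtain ⟨j, -, rfl⟩ := List.mem_map.1 hl
        exact (List.pairwise_lt_finRange _).map _ fun a b hab => Sigma.Lex.right _ _ hab
      · refine (List.pairwise_lt_finRange _).map _ fun j k hjk x hx y hy => ?_
        obtain ⟨a, -, rfl⟩ := List.mem_map.1 hx
        obtain ⟨b, -, rfl⟩ := List.mem_map.1 hy
        exact Sigma.Lex.left _ _ hjk
    refine List.Perm.eq_of_pairwise' (r := (· < ·))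
      ((List.pairwise_lt_finRange L).map _ fun a b hab => e.symm.strictMono hab) hpw ?_
    refine (List.perm_ext_iff_of_nodup hnd (hpw.imp ne_of_lt)).2 fun s => ?_
    obtain ⟨j, a⟩ := s
    refine iff_of_true ?_ ?_
    · exact List.mem_map.2 ⟨e ⟨j, a⟩, List.mem_finRange _, e.symm_apply_apply _⟩
    · exact List.mem_flatten.2 ⟨_, List.mem_map.2 ⟨j, List.mem_finRange _, rfl⟩,
        List.mem_map.2 ⟨a, List.mem_finRange _, rfl⟩⟩
  have h1 := congrArg (fun l => (l.map f).prod) key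
  simp only [List.map_map, List.map_flatten, List.prod_flatten] at h1
  simp only [List.ofFn_eq_map]
  simpa [Function.comp_def] using h1

section transport

variable {ι ι' U K D : Type*} [Fintype ι] [LinearOrder ι] [Fintype ι'] [LinearOrder ι'] [Field K]

omit [Field K] in
theorem pairProd_comp_orderIso [CommMonoid K] (P : D → D → K) (d : ι → D) (e : ι' ≃o ι) :
    pairProd P (d ∘ e) = pairProd P d := by
  unfold pairProd
  rw [← e.toEquiv.prod_comp]
  refine Finset.prod_congr rfl fun i _ => ?_
  rw [← e.toEquiv.prod_comp]
  refine Finset.prod_congr rfl fun j _ => ?_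
  exact if_congr e.lt_iff_lt.symm rfl rfl

theorem layerWeight_comp_orderIso [Fintype U] (h : K) (x : U → K) (κ : U → ℕ) (I : ι → ℕ)
    (e : ι' ≃o ι) : ∀ (m : ℕ) (z : ι → Option U),
    layerWeight h x κ (I ∘ e) m (z ∘ e) = layerWeight h x κ I m z
  | 0, _ => rfl
  | m + 1, z => by
    classical
    rw [layerWeight, layerWeight]
    refine (Fintype.sum_equiv (Equiv.arrowCongr e.symm.toEquiv (Equiv.refl (Option U))) _ _
      fun σ => ?_).symm
    have h1 : (Equiv.arrowCongr e.symm.toEquiv (Equiv.refl (Option U))) σ = σ ∘ e := rfl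
    rw [h1, layerWeight_comp_orderIso h x κ I e m σ]
    refine if_congr (IsLayer.comp_iff e.toEquiv).symm ?_ rfl
    congr 2
    exact (pairProd_comp_orderIso _ _ e).symm

end transport

section unroll

variable {ι U K : Type*} [Fintype ι] [LinearOrder ι] [Fintype U] [Field K]

open Classical in
theorem layerWeight_eq_sum (h : K) (X : U → K) (κ : U → ℕ) (I : ι → ℕ) : ∀ (m : ℕ)
    (z : ι → Option U), layerWeight h X κ I m z =
      ∑ σ : Fin m → ι → Option U, ∏ p : Fin m, if IsLayer κ I p (σ p) then
        h ^ Fintype.card {u // κ u ≤ p} * pairProd (pairFactor h X)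
          (fun i => (Fin.snoc (α := fun _ => ι → Option U) σ z p.succ i, σ p i)) else 0
  | 0, z => by simp [layerWeight]
  | m + 1, z => by
    rw [layerWeight, ← (Fin.snocEquiv fun _ : Fin (m + 1) => ι → Option U).sum_comp,
      Fintype.sum_prod_type]
    refine Finset.sum_congr rfl fun τ _ => ?_
    have key : ∀ σ : Fin m → ι → Option U, (∏ p : Fin (m + 1),
        if IsLayer κ I p (Fin.snoc (α := fun _ => ι → Option U) σ τ p) then
          h ^ Fintype.card {u // κ u ≤ p} * pairProd (pairFactor h X)
            (fun i => (Fin.snoc (α := fun _ => ι → Option U)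
              (Fin.snoc (α := fun _ => ι → Option U) σ τ) z p.succ i,
              Fin.snoc (α := fun _ => ι → Option U) σ τ p i)) else 0) =
        (∏ p : Fin m, if IsLayer κ I p (σ p) then
          h ^ Fintype.card {u // κ u ≤ p} * pairProd (pairFactor h X)
            (fun i => (Fin.snoc (α := fun _ => ι → Option U) σ τ p.succ i, σ p i)) else 0) *
        if IsLayer κ I m τ then
          h ^ Fintype.card {u // κ u ≤ m} * pairProd (pairFactor h X) (fun i => (z i, τ i)) else 0 := by
      intro σ
      rw [Fin.prod_univ_castSucc]
      simp only [Fin.succ_castSucc, Fin.snoc_castSucc, Fin.succ_last, Fin.snoc_last,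
        Fin.val_castSucc, Fin.val_last]
    rw [layerWeight_eq_sum h X κ I m τ]
    refine Eq.trans ?_ (Finset.sum_congr rfl fun σ _ => (key σ).symm)
    rw [← Finset.sum_mul, mul_comm]
    split_ifs <;> simp

end unroll

section weight

theorem prod_subtype_eq_prod_dite {ι K : Type*} [Fintype ι] [CommMonoid K] (P : ι → Prop)
    [DecidablePred P] (G : {i // P i} → K) :
    ∏ a, G a = ∏ i, if hi : P i then G ⟨i, hi⟩ else 1 := by
  rw [Finset.prod_dite]
  simp only [Finset.prod_const_one, mul_one]
  refine Fintype.prod_equiv (Equiv.subtypeEquivRight fun i => by simp) _ _ fun a => rfl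

theorem prod_prod_subtype {ι K : Type*} [Fintype ι] [CommMonoid K] (P Q : ι → Prop)
    [DecidablePred P] [DecidablePred Q] (G : {i // P i} → {i // Q i} → K) :
    ∏ a, ∏ b, G a b =
      ∏ i, ∏ j, if hi : P i then if hj : Q j then G ⟨i, hi⟩ ⟨j, hj⟩ else 1 else 1 := by
  rw [prod_subtype_eq_prod_dite]
  refine Finset.prod_congr rfl fun i _ => ?_
  split_ifs
  · rw [prod_subtype_eq_prod_dite]
  · simp

variable {M : ℕ} {ι U K : Type*} [Fintype ι] [LinearOrder ι] [Fintype U] [Field K]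

theorem weight_eq_layerWeight (h : K) (X : U → K) (κ : U → ℕ) (I : ι → Fin (M + 1))
    (τ : ∀ p : Fin M, Layer I p.castSucc ≃ {u // κ u ≤ p}) (w : ι → U) :
    weight h I (fun p a => X (τ p a)) (fun i => X (w i)) =
      layerWeight h X κ (fun i => I i) M (some ∘ w) := by
  classical
  rw [layerWeight_eq_sum, weight]
  let Φ : (∀ p : Fin M, Equiv.Perm (Layer I p.castSucc)) → Fin M → ι → Option U := fun σ p i =>
    if hi : I i ≤ p.castSucc then some (τ p (σ p ⟨i, hi⟩)).1 else none
  have hΦ : ∀ σ (p : Fin M), IsLayer κ (fun i => (I i : ℕ)) p (Φ σ p) := by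
    intro σ p
    refine ⟨fun i => ?_, fun u => ?_, fun i j u hi hj => ?_⟩
    · simp [Φ, Fin.le_def]
    · constructor
      · intro hu
        refine ⟨((σ p).symm ((τ p).symm ⟨u, hu⟩)).1, ?_⟩
        simp only [Φ]
        rw [dif_pos ((σ p).symm ((τ p).symm ⟨u, hu⟩)).2]
        simp
      · rintro ⟨i, hi⟩
        simp only [Φ] at hi
        split_ifs at hi with h1
        simp only [Option.some.injEq] at hi
        rw [← hi]
        exact (τ p (σ p ⟨i, h1⟩)).2
    · simp only [Φ] at hi hj
      split_ifs at hi hj with h1 h2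
      simp only [Option.some.injEq] at hi hj
      have := (σ p).injective ((τ p).injective (Subtype.ext (hi.trans hj.symm)))
      exact congrArg Subtype.val this
  refine Finset.sum_of_injOn Φ ?_ (fun _ _ => Finset.mem_coe.2 (Finset.mem_univ _)) ?_ ?_
  · intro σ _ σ' _ hσ
    ext p a
    have h1 := congrFun (congrFun hσ p) a.1
    simp only [Φ] at h1
    rw [dif_pos a.2, dif_pos a.2, Option.some.injEq] at h1
    exact congrArg Subtype.val ((τ p).injective (Subtype.ext h1))
  · intro ρ _ hρ
    by_contra h0
    refine hρ ?_
    have h1 : ∀ p : Fin M, IsLayer κ (fun i => (I i : ℕ)) p (ρ p) := fun p => by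
      have := Finset.prod_ne_zero_iff.1 h0 p (Finset.mem_univ _)
      by_contra h2
      rw [if_neg h2] at this
      exact this rfl
    have h2 : ∀ p (a : Layer I p.castSucc), ∃ u, ρ p a.1 = some u := fun p a =>
      Option.ne_none_iff_exists'.1 (((h1 p).1 a.1).2 (Fin.le_def.1 a.2))
    choose f hf using h2
    have h3 : ∀ p a, κ (f p a) ≤ p := fun p a => ((h1 p).2.1 _).2 ⟨_, hf p a⟩
    have h4 : ∀ p, Function.Injective fun a => (τ p).symm ⟨f p a, h3 p a⟩ := by
      intro p a b hab
      have h5 := congrArg Subtype.val ((τ p).symm.injective hab)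
      simp only at h5
      have h6 := hf p b
      rw [← h5] at h6
      exact Subtype.ext ((h1 p).2.2 _ _ _ (hf p a) h6)
    refine ⟨fun p => Equiv.ofBijective _ (Finite.injective_iff_bijective.1 (h4 p)),
      Finset.mem_coe.2 (Finset.mem_univ _), ?_⟩
    ext1 p
    ext1 i
    simp only [Φ]
    split_ifs with hi
    · simp [hf p ⟨i, hi⟩]
    · by_contra h5
      exact hi (((h1 p).1 i).1 (Ne.symm h5))
  · intro σ _
    have hlv : ∀ (q : Fin (M + 1)) (i : ι) (hi : I i ≤ q), ∃ u,
        Fin.snoc (α := fun _ => ι → Option U) (Φ σ) (some ∘ w) q i = some u ∧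
          layerVar I (fun p a => X (τ p a)) (fun i => X (w i)) σ q ⟨i, hi⟩ = X u := by
      intro q
      induction q using Fin.lastCases with
      | last => exact fun i hi => ⟨w i, by simp, by simp [layerVar]⟩
      | cast p => exact fun i hi => ⟨_, by rw [Fin.snoc_castSucc]; exact dif_pos hi,
          by simp [layerVar]⟩
    have hln : ∀ (q : Fin (M + 1)) (i : ι) (hi : ¬ I i ≤ q),
        Fin.snoc (α := fun _ => ι → Option U) (Φ σ) (some ∘ w) q i = none := by
      intro q
      induction q using Fin.lastCases with
      | last => exact fun i hi => absurd (Fin.le_last _) hi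
      | cast p => exact fun i hi => by rw [Fin.snoc_castSucc]; exact dif_neg hi
    have hopt : ∀ (G : K → K → K) (q r : Fin (M + 1)) (i j : ι),
        optMap₂ (fun u v => G (X u) (X v))
          (Fin.snoc (α := fun _ => ι → Option U) (Φ σ) (some ∘ w) q i)
          (Fin.snoc (α := fun _ => ι → Option U) (Φ σ) (some ∘ w) r j) =
        if hi : I i ≤ q then if hj : I j ≤ r then
          G (layerVar I (fun p a => X (τ p a)) (fun i => X (w i)) σ q ⟨i, hi⟩)
            (layerVar I (fun p a => X (τ p a)) (fun i => X (w i)) σ r ⟨j, hj⟩) else 1 else 1 := by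
      intro G q r i j
      by_cases hi : I i ≤ q
      · obtain ⟨u, hu, hu'⟩ := hlv q i hi
        by_cases hj : I j ≤ r
        · obtain ⟨v, hv, hv'⟩ := hlv r j hj
          rw [hu, hv, dif_pos hi, dif_pos hj, hu', hv']
          rfl
        · rw [hln r j hj, dif_pos hi, dif_neg hj, hu]
          rfl
      · rw [hln q i hi, dif_neg hi]
        rfl
    refine Finset.prod_congr rfl fun p _ => ?_
    rw [if_pos (hΦ σ p)]
    have hcast : Φ σ p = Fin.snoc (α := fun _ => ι → Option U) (Φ σ) (some ∘ w) p.castSucc := by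
      rw [Fin.snoc_castSucc]
    have hcard : Fintype.card {u // κ u ≤ p} = Fintype.card (Layer I p.castSucc) :=
      Fintype.card_congr (τ p).symm
    simp only [hcast, pairProd, pairFactor, hopt (fun v t => t - v), hopt (fun t v => t - v + h),
      hopt (fun t t' => (t - t' - h) / (t - t'))]
    simp only [Finset.prod_mul_distrib, Finset.prod_const, Finset.card_univ, hcard,
      Finset.prod_filter]
    have hcomm : (∏ a : Layer I p.castSucc, ∏ i : Layer I p.succ, if i.1 < a.1 then
          (layerVar I (fun p a => X (τ p a)) (fun i => X (w i)) σ p.castSucc a -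
            layerVar I (fun p a => X (τ p a)) (fun i => X (w i)) σ p.succ i) else 1) =
        ∏ i : Layer I p.succ, ∏ a : Layer I p.castSucc, if i.1 < a.1 then
          (layerVar I (fun p a => X (τ p a)) (fun i => X (w i)) σ p.castSucc a -
            layerVar I (fun p a => X (τ p a)) (fun i => X (w i)) σ p.succ i) else 1 :=
      Finset.prod_comm
    rw [hcomm, prod_prod_subtype, prod_prod_subtype, prod_prod_subtype]
    rw [mul_comm (∏ i, ∏ j, _) (h ^ _), mul_assoc, mul_assoc]
    congr 1
    simp only [← Finset.prod_mul_distrib]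
    refine Finset.prod_congr rfl fun i _ => Finset.prod_congr rfl fun j _ => ?_
    by_cases hij : i < j
    · simp only [hij, if_true, mul_assoc, Subtype.mk_lt_mk]
    · simp [hij]

end weight
section prefactor

variable {M : ℕ} {n : Fin (M + 1) → ℕ} {K : Type*}

theorem prod_block_eq [CommMonoid K] {U : Type*} [Fintype U] (E : Var n ≃ U) (j : Fin (M + 1)) (f : U → K) :
    ∏ a, f (E ⟨j, a⟩) = ∏ u, if (E.symm u).1 = j then f u else 1 := by
  rw [← E.prod_comp, Fintype.prod_sigma, Finset.prod_eq_single j]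
  · simp
  · intro k _ hk
    exact Finset.prod_eq_one fun a _ => by simp [hk]
  · exact fun h0 => absurd (Finset.mem_univ _) h0

theorem diffProd_eq_prod [Field K] {U : Type*} [Fintype U] (c : K) (X : U → K) (E F : Var n ≃ U)
    (j k : Fin (M + 1)) : diffProd c (fun a => X (E ⟨j, a⟩)) (fun a => X (F ⟨k, a⟩)) =
      ∏ u, ∏ v, if (E.symm u).1 = j ∧ (F.symm v).1 = k then X u - X v + c else 1 := by
  rw [diffProd, prod_block_eq E j fun t => ∏ b, (X t - X (F ⟨k, b⟩) + c)]
  refine Finset.prod_congr rfl fun u _ => ?_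
  rw [prod_block_eq F k fun t => X u - X t + c]
  split_ifs with h1 <;> simp [h1]

theorem prod_prod_prod_comm [CommMonoid K] {U J : Type*} [Fintype U] (s : Finset J)
    (f : J → U → U → K) :
    ∏ j ∈ s, ∏ u, ∏ v, f j u v = ∏ u, ∏ v, ∏ j ∈ s, f j u v := by
  rw [Finset.prod_comm]
  exact Finset.prod_congr rfl fun u _ => Finset.prod_comm

variable [Field K]

theorem prod_ite_lt (c d : Fin (M + 1)) (t : K) :
    (∏ k : Fin M, ∏ j ∈ Finset.Iic k.castSucc, if c = k.succ ∧ d = j then t else 1) =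
      if d < c then t else 1 := by
  have h1 : ∀ k : Fin M, (∏ j ∈ Finset.Iic k.castSucc, if c = k.succ ∧ d = j then t else 1) =
      if c = k.succ then (if d ≤ k.castSucc then t else 1) else 1 := fun k => by
    split_ifs with h2 h3
    · simp [h2, h3]
    · simp [h2, h3]
    · simp [h2]
  simp only [h1]
  induction c using Fin.cases with
  | zero => simp [Fin.succ_ne_zero, eq_comm]
  | succ c => simp [Fin.succ_inj, Fin.le_castSucc_iff]

theorem prod_ite_le (c d : Fin (M + 1)) (t : K) :
    (∏ k : Fin M, ∏ j ∈ Finset.Iic k.castSucc, if c = j ∧ d = k.castSucc then t else 1) =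
      if c ≤ d ∧ d < Fin.last M then t else 1 := by
  have h1 : ∀ k : Fin M, (∏ j ∈ Finset.Iic k.castSucc, if c = j ∧ d = k.castSucc then t else 1) =
      if d = k.castSucc then (if c ≤ k.castSucc then t else 1) else 1 := fun k => by
    split_ifs with h2 h3
    · simp [h2, h3]
    · simp [h2, h3]
    · simp [h2]
  simp only [h1]
  induction d using Fin.lastCases with
  | last => simp [(Fin.castSucc_lt_last _).ne']
  | cast d => simp [Fin.castSucc_inj, Fin.castSucc_lt_last]

theorem prod_ite_castSucc_right (P : Prop) [Decidable P] (d : Fin (M + 1)) (t : K) :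
    (∏ k : Fin M, if P ∧ d = k.castSucc then t else 1) =
      if P ∧ d < Fin.last M then t else 1 := by
  induction d using Fin.lastCases with
  | last => simp [(Fin.castSucc_lt_last _).ne']
  | cast d => by_cases hP : P <;> simp [hP, Fin.castSucc_inj, Fin.castSucc_lt_last]

theorem prod_ite_castSucc_left (P : Prop) [Decidable P] (d : Fin (M + 1)) (t : K) :
    (∏ k : Fin M, if d = k.castSucc ∧ P then t else 1) =
      if d < Fin.last M ∧ P then t else 1 := by
  simp only [and_comm (b := P)]
  exact prod_ite_castSucc_right P d t

theorem prod_ite_lt_le (a b : Fin (M + 1)) (t : K) :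
    (∏ l : Fin M, ∏ j ∈ Finset.Iio l.castSucc, ∏ k ∈ Finset.Iic l.castSucc,
      if a = j ∧ b = k then t else 1) =
      ∏ l ∈ Finset.range M, if a < l ∧ b ≤ l then t else 1 := by
  rw [← Fin.prod_univ_eq_prod_range (fun l => if (a : ℕ) < l ∧ (b : ℕ) ≤ l then t else 1)]
  refine Finset.prod_congr rfl fun l _ => ?_
  have h1 : ∀ j, (∏ k ∈ Finset.Iic l.castSucc, if a = j ∧ b = k then t else 1) =
      if a = j then (if b ≤ l.castSucc then t else 1) else 1 := fun j => by
    split_ifs with h2 h3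
    · simp [h2, h3]
    · simp [h2, h3]
    · simp [h2]
  simp only [h1]
  simp [Fin.lt_def, Fin.le_def, ite_and]

theorem prod_range_succ_ite {a b : ℕ} (hb : b ≤ M) (t : K) :
    (∏ p ∈ Finset.range M, if a ≤ p ∧ b ≤ p + 1 then t else 1) =
      (∏ l ∈ Finset.range M, if a < l ∧ b ≤ l then t else 1) * if a < M then t else 1 := by
  rcases M with _ | m
  · simp
  · rw [Finset.prod_range_succ, Finset.prod_range_succ' (fun l => if a < l ∧ b ≤ l then t else 1)]
    simp [hb]

theorem prefactor_mul_prod_eq {U : Type*} [Fintype U] (h : K) (X : U → K)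
    (hX : Function.Injective X) (hgen : ∀ u v, X u - X v + h ≠ 0) (E F : Var n ≃ U) :
    prefactor h (fun j a => X (E ⟨j, a⟩)) (fun j a => X (F ⟨j, a⟩)) *
      (∏ p ∈ Finset.range M, ∏ u, ∏ v,
        if ((E.symm u).1 : ℕ) ≤ p ∧ ((E.symm v).1 : ℕ) ≤ p + 1 then X u - X v + h else 1) =
    ∏ u, ∏ v, if ((F.symm v).1 : ℕ) < (F.symm u).1 then (X u - X v + h) / (X u - X v) else 1 := by
  unfold prefactor
  simp only [diffProd_eq_prod, Finset.prod_mul_distrib, prod_prod_prod_comm, prod_ite_lt,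
    prod_ite_le, prod_ite_castSucc_right, prod_ite_castSucc_left, prod_ite_lt_le]
  simp only [← Finset.prod_mul_distrib, ← Finset.prod_inv_distrib, ← Finset.prod_div_distrib]
  refine Finset.prod_congr rfl fun u _ => Finset.prod_congr rfl fun v _ => ?_
  rw [prod_range_succ_ite (Fin.is_le _)]
  have hR : (∏ l ∈ Finset.range M, if ((E.symm u).1 : ℕ) < l ∧ ((E.symm v).1 : ℕ) ≤ l then
      X u - X v + h else 1) ≠ 0 := Finset.prod_ne_zero_iff.2 fun l _ => by
    split_ifs
    · exact hgen u v
    · exact one_ne_zero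
  set R := ∏ l ∈ Finset.range M, if ((E.symm u).1 : ℕ) < l ∧ ((E.symm v).1 : ℕ) ≤ l then
      X u - X v + h else 1
  have hφ := hgen u v
  set φ := X u - X v + h
  have hδ : (F.symm v).1 < (F.symm u).1 → X u - X v + 0 ≠ 0 := fun h1 h2 => by
    rw [add_zero, sub_eq_zero] at h2
    rw [hX h2] at h1
    exact lt_irrefl _ h1
  rw [add_zero] at hδ ⊢
  generalize (E.symm u).1 = a
  generalize (F.symm u).1 = c at *
  generalize (F.symm v).1 = d at *
  have ha : (a : ℕ) < M ↔ a < Fin.last M := Iff.rfl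
  simp only [ha, Fin.val_fin_lt]
  rcases lt_or_ge d c with h1 | h1
  · have h2 : d < Fin.last M := h1.trans_le (Fin.le_last _)
    have h3 := hδ h1
    rcases (Fin.le_last a).lt_or_eq with h4 | h4
    · simp [h1, h2, h4, h4.ne, h2.ne, h1.not_ge]
      field_simp
    · simp [h1, h2, h4, h2.ne, h1.not_ge]
      field_simp
  · rcases (Fin.le_last a).lt_or_eq with h4 | h4 <;> rcases (Fin.le_last d).lt_or_eq with h2 | h2
    · simp [h1, h2, h4, h4.ne, h2.ne, h1.not_gt]
      field_simp
    · simp [h2, h4, h4.ne, (h2 ▸ h1).not_gt]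
      field_simp
    · simp [h1, h2, h4, h2.ne, h1.not_gt]
      field_simp
    · simp [h2, h4, (h2 ▸ h1).not_gt]
      field_simp

end prefactor
variable {M : ℕ} {n : Fin (M + 1) → ℕ}

/-- The bijection of the variables with the listed elements of the blocks of a partition. -/
noncomputable def VarPartition.equiv (Y : VarPartition n) (enum : ∀ j, Fin (n j) ≃ Y.1 j) : Var n ≃ Var n :=
  Equiv.ofBijective (fun s => (enum s.1 s.2).1) <| by
    refine Finite.injective_iff_bijective.1 ?_
    rintro ⟨j, a⟩ ⟨k, b⟩ hs
    simp only at hs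
    obtain rfl : j = k := (Y.2.2 (enum j a).1).unique (enum j a).2 (hs ▸ (enum k b).2)
    rw [(enum j).injective (Subtype.ext hs)]

theorem VarPartition.equiv_symm_fst_eq_iff (Y : VarPartition n) (enum : ∀ j, Fin (n j) ≃ Y.1 j)
    (u : Var n) (j : Fin (M + 1)) : ((Y.equiv enum).symm u).1 = j ↔ u ∈ Y.1 j := by
  obtain ⟨s, rfl⟩ := (Y.equiv enum).surjective u
  rw [Equiv.symm_apply_apply]
  have h1 : Y.equiv enum s ∈ Y.1 s.1 := (enum s.1 s.2).2
  exact ⟨fun h => h ▸ h1, fun h => (Y.2.2 _).unique h1 h⟩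

theorem specialWeight_eq_layerWeight {K : Type*} [Field K] (h : K) (X : Var n → K) (F : Var n ≃ Var n)
    {L : ℕ} (e : (Σₗ j, Fin (n j)) ≃o Fin L) :
    specialWeight h (fun j a => X ⟨j, a⟩) (fun j a => X (F ⟨j, a⟩)) =
      layerWeight h X (fun u => u.1) (fun i => (ofLex (e.symm i)).1) M
        (some ∘ fun i => F (ofLex (e.symm i))) := by
  rw [← layerWeight_comp_orderIso _ _ _ _ e]
  have h1 := weight_eq_layerWeight h X (fun u : Var n => (u.1 : ℕ))
    (fun s : Σₗ j, Fin (n j) => (ofLex s).1)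
    (fun p => (ofLex.subtypeEquiv fun s => by rfl : Layer _ p.castSucc ≃ _))
    (fun s => F (ofLex s))
  refine Eq.trans h1 ?_
  congr 1
  · ext s
    simp
  · ext1 s
    simp

theorem VarPartition.exists_equiv_symm_fst_eq {L : ℕ} (e : (Σₗ j, Fin (n j)) ≃o Fin L)
    (w : Fin L ≃ Var n) : ∃ Y : VarPartition n, ∀ (enum : ∀ j, Fin (n j) ≃ Y.1 j) (i : Fin L),
      ((Y.equiv enum).symm (w i)).1 = (ofLex (e.symm i)).1 := by
  refine ⟨⟨fun j => Finset.univ.filter fun u => (ofLex (e.symm (w.symm u))).1 = j, fun j => ?_,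
    fun u => ⟨(ofLex (e.symm (w.symm u))).1, by simp, fun j hj => by simpa [eq_comm] using hj⟩⟩,
    fun enum i => ?_⟩
  · rw [← Fintype.card_subtype, ← Fintype.card_fin (n j)]
    let G : Var n ≃ Var n := w.symm.trans (e.symm.toEquiv.trans ofLex)
    exact Fintype.card_congr ((G.subtypeEquiv fun u => Iff.rfl).trans (Equiv.sigmaSubtype j))
  · exact (VarPartition.equiv_symm_fst_eq_iff _ enum (w i) _).2
      (Finset.mem_filter.2 ⟨Finset.mem_univ _, by simp⟩)

end YangianCommutation

open YangianCommutation

theorem theorem5 (M : ℕ) (h : ℂ) (hh : h ≠ 0) (n : Fin (M + 1) → ℕ)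
    (enum : ∀ (Y : VarPartition n) (j : Fin (M + 1)), Fin (n j) ≃ Y.1 j) :
    (List.ofFn fun j : Fin (M + 1) => (List.ofFn fun a : Fin (n j) =>
        T h (Fin.last M) j
          (⟨j, a⟩ : Var n)).prod).prod =
      ∑ Y : VarPartition n,
        (prefactor (algebraMap ℂ _ h)
            (fun j a => spec (⟨j, a⟩ : Var n))
            (fun j a => spec (enum Y j a).1) *
          specialWeight (algebraMap ℂ _ h)
            (fun j a => spec (⟨j, a⟩ : Var n))
            (fun j a => spec (enum Y j a).1)) •
        (List.ofFn fun j : Fin (M + 1) => (List.ofFn fun a : Fin (n j.rev) =>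
          T h (Fin.last M) j.rev (enum Y j.rev a).1).prod).prod := by
  let L := Fintype.card (Σₗ j, Fin (n j))
  let R : (Σ j : Fin (M + 1), Fin (n j.rev)) ≃ Var n :=
    Equiv.sigmaCongrLeft (β := fun j => Fin (n j)) Fin.revPerm
  let e : (Σₗ j, Fin (n j)) ≃o Fin L := (Fintype.orderIsoFinOfCardEq _ rfl).symm
  let e' : (Σₗ j : Fin (M + 1), Fin (n j.rev)) ≃o Fin L :=
    (Fintype.orderIsoFinOfCardEq _ (Fintype.card_congr (ofLex.trans (R.trans toLex)))).symm
  let z₀ : Fin L ≃ Var n := e.symm.toEquiv.trans ofLex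
  let F : VarPartition n → Var n ≃ Var n := fun Y => Y.equiv (enum Y)
  let z : VarPartition n → Fin L ≃ Var n := fun Y => z₀.trans (F Y)
  let z' : VarPartition n → Fin L ≃ Var n := fun Y =>
    (e'.symm.toEquiv.trans ofLex).trans (R.trans (F Y))
  let I : Fin L → ℕ := fun i => (z₀ i).1
  let κ : VarPartition n → Var n → ℕ := fun Y u => ((F Y).symm u).1
  have hX : Function.Injective (spec : Var n → _) := spec_injective
  have hgen := spec_sub_spec_add_ne_zero (σ := Var n) hh
  have hA := isExchangeFamily_prod (L := L) (x := (spec : Var n → _))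
    (A := fun c u => T h (Fin.last M) (Fin.ofNat (M + 1) c) u)
    fun i j u v => T_exchange (h := h) u v (Fin.last M) (Fin.ofNat (M + 1) i) (Fin.ofNat (M + 1) j)
  have hfst : ∀ {m : Fin (M + 1) → ℕ} {s t : Σₗ j, Fin (m j)}, s ≤ t → (ofLex s).1 ≤ (ofLex t).1 := by
    intro m s t hst
    rcases Sigma.Lex.le_def.1 hst with h1 | ⟨h1, -⟩
    · exact h1.le
    · exact h1.le
  have hκz' : ∀ Y i, κ Y (z' Y i) = (ofLex (e'.symm i)).1.rev := fun Y i =>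
    congrArg (fun u : Var n => (u.1 : ℕ)) ((F Y).symm_apply_apply (R (ofLex (e'.symm i))))
  have hofNat : ∀ c : Fin (M + 1), Fin.ofNat (M + 1) c = c := fun c => by
    ext
    simp [Fin.ofNat, Nat.mod_eq_of_lt c.2]
  have key := exchange_expansion (h := algebraMap ℂ (RatFun (Var n)) h) (x := spec) (M := M)
    hX hgen hA (I := I) (fun i j hij => hfst (e.symm.monotone hij))
    (fun i => Fin.is_le _) (κ := κ) (z := z) (z' := z') ?_ ?_ ?_ ?_ (κ₀ := fun u => u.1) (z₀ := z₀)
    (fun i => rfl)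
  rotate_left
  · intro Y Y' hY
    refine Subtype.ext (funext fun j => Finset.ext fun u => ?_)
    rw [← Y.equiv_symm_fst_eq_iff (enum Y), ← Y'.equiv_symm_fst_eq_iff (enum Y'),
      Fin.ext_iff, Fin.ext_iff]
    exact Eq.congr_left (congrFun hY u)
  · intro Y i
    simp [κ, z, I]
  · intro Y i j hij
    have h1 := hfst (e'.symm.monotone hij)
    simp only [Function.comp_apply, hκz']
    exact Fin.rev_le_rev.2 h1
  · intro w
    obtain ⟨Y, hY⟩ := VarPartition.exists_equiv_symm_fst_eq e w
    exact ⟨Y, fun i => congrArg Fin.val (hY (enum Y) i)⟩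
  have hP : (∏ p ∈ Finset.range M, ∏ u : Var n, ∏ v : Var n, if (u.1 : ℕ) ≤ p ∧ (v.1 : ℕ) ≤ p + 1 then
      spec u - spec v + algebraMap ℂ (RatFun (Var n)) h else 1) ≠ 0 := by
    refine Finset.prod_ne_zero_iff.2 fun p _ => Finset.prod_ne_zero_iff.2 fun u _ =>
      Finset.prod_ne_zero_iff.2 fun v _ => ?_
    split_ifs
    · exact hgen u v
    · exact one_ne_zero
  have hleft : (List.ofFn fun k => T h (Fin.last M) (Fin.ofNat (M + 1) (I k)) (z₀ k)).prod =
      (List.ofFn fun j : Fin (M + 1) => (List.ofFn fun a : Fin (n j) =>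
        T h (Fin.last M) j (⟨j, a⟩ : Var n)).prod).prod := by
    refine Eq.trans ?_ (List.prod_ofFn_orderIso_sigma e fun s =>
      T h (Fin.last M) (ofLex s).1 (ofLex s))
    simp only [I, hofNat]
    rfl
  have hright : ∀ Y, (List.ofFn fun k => T h (Fin.last M) (Fin.ofNat (M + 1) ((κ Y ∘ z' Y) k))
      (z' Y k)).prod = (List.ofFn fun j : Fin (M + 1) => (List.ofFn fun a : Fin (n j.rev) =>
          T h (Fin.last M) j.rev (enum Y j.rev a).1).prod).prod := by
    intro Y
    refine Eq.trans ?_ (List.prod_ofFn_orderIso_sigma e' fun s => T h (Fin.last M) (ofLex s).1.rev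
      (enum Y (ofLex s).1.rev (ofLex s).2).1)
    simp only [Function.comp_apply, hκz', hofNat]
    rfl
  simp only [hleft, hright] at key
  refine (IsUnit.mk0 _ hP).smul_left_cancel.1 (key.trans ?_)
  simp only [Finset.smul_sum, smul_smul]
  refine Finset.sum_congr rfl fun Y _ => ?_
  congr 1
  rw [← prefactor_mul_prod_eq _ _ hX hgen (Equiv.refl _) (F Y)]
  have hW := specialWeight_eq_layerWeight (algebraMap ℂ (RatFun (Var n)) h) spec (F Y) e
  have hmul : ∀ a b c : RatFun (Var n), a * (b * c) = c * (b * a) := fun a b c => by ring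
  exact (congrArg (· * _) hW.symm).trans (hmul _ _ _)
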